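/- All graphs are finite, simple, undirected, connected and non-empty. A \emph{Generic Search (GS) ordering} of a graph $G$ with $n$ vertices is an ordering $\sigma=(v_1,\dots,v_n)$ of its vertices such that every $v_i$ with $i>1$ has a neighbor $v_j$ with $j<i$. The \emph{$\mathcal F$-tree} (first-in tree) of $\sigma$ is the spanning tree of $G$ rooted at $v_1$ in which the parent of each $v_i$, $i>1$, is the neighbor of $v_i$ in $G$ that is leftmost in $\sigma$. A \emph{leaf} of a rooted tree is a vertex other than the root that has no descendants. The problem Max-Leaf $\mathcal F$-Tree of Generic Search asks, given a graph $G$ and an integer $k\ge 0$, whether $G$ has a GS ordering whose $\mathcal F$-tree has at least $k$ leaves. **Corollary.** Max-Leaf $\mathcal F$-Tree of Generic Search, parameterized by the number $k$ of leaves, is in $\mathsf{FPT}$: there are a computable function $f:\mathbb N\to\mathbb N$, a constant $c$ and a deterministic multi-stack (equivalently, multi-tape) Turing machine that decides every instance $(x,k)$ in at most $f(k)\cdot(|x|+k+1)^c$ steps, where $x$ is a binary string and $|x|$ its length, a graph on $\{0,\dots,n-1\}$ is encoded as $1^n0$ followed by its adjacency matrix row by row, the machine receives the string $1^k0x$ and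 outputs one bit, and an $x$ that does not encode a connected non-empty graph is a no-instance. -/

import Mathlib

/-! ### Fixed-parameter tractability -/

/-- A parameterized problem over the binary alphabet: a set of pairs `(x, k)` of a string `x` and
a parameter `k`. -/
abbrev ParamProblem : Type := Set (List Bool × ℕ)

/-- The input string of the instance `(x, k)`: the parameter in unary, a separator, and then `x`.
Its length is `|x| + k + 1`. -/
def encodeInstance (x : List Bool) (k : ℕ) : List Bool :=
  List.replicate k true ++ false :: x

open Classical in
/-- The class of fixed-parameter tractable problems: `L` is in `FPT` if there are a computable
function `f`, a constant `c` and one (deterministic, multi-stack) Turing machine which on every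
input `(x, k)` halts after at most `f k * (|x| + k + 1) ^ c` steps, with output the single bit
telling whether `(x, k)` belongs to `L`. The machine has finitely many stacks, labels and internal
states by definition of `Turing.FinTM2`; all its stack alphabets are required to be finite too. -/
def FPT : Set ParamProblem :=
  {L | ∃ f : ℕ → ℕ, Computable f ∧ ∃ c : ℕ, ∃ M : Turing.TM2ComputableAux Bool Bool,
    (∀ s : M.tm.K, Finite (M.tm.Γ s)) ∧
    ∀ (x : List Bool) (k : ℕ),
      Nonempty (Turing.TM2OutputsInTime M.tm
        ((encodeInstance x k).map M.inputAlphabet.invFun)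
        (some ([decide ((x, k) ∈ L)].map M.outputAlphabet.invFun))
        (f k * (encodeInstance x k).length ^ c))}

open Classical in
/-- The encoding of a graph on the vertex set `{0, …, n - 1}`: the number `n` in unary, a
separator, and the adjacency matrix row by row. -/
noncomputable def encodeGraph {n : ℕ} (G : SimpleGraph (Fin n)) : List Bool :=
  List.replicate n true ++ false ::
    (List.finRange n).flatMap fun i => (List.finRange n).map fun j => decide (G.Adj i j)

/-! ### Rooted spanning trees -/

section Trees

variable {V : Type*}

/-- `T` is a spanning tree of `G` (as `T` lives on the vertex set of `G`, it spans). -/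
def IsSpanningTree (G T : SimpleGraph V) : Prop :=
  T ≤ G ∧ T.IsTree

/-- In the tree `T` rooted at `r`, the vertex `v` is a (proper) descendant of `u`: `u ≠ v` lies on
the path of `T` from the root to `v`. -/
def IsDescendant (T : SimpleGraph V) (r u v : V) : Prop :=
  u ≠ v ∧ ∃ p : T.Walk r v, p.IsPath ∧ u ∈ p.support

/-- In the tree `T` rooted at `r`, the vertex `u` is the parent of `v`. -/
def IsParent (T : SimpleGraph V) (r u v : V) : Prop :=
  T.Adj u v ∧ IsDescendant T r u v

/-- The leaves of the tree `T` rooted at `r`: the vertices without descendants; the root is never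
counted as a leaf. -/
def leaves (T : SimpleGraph V) (r : V) : Set V :=
  {v | v ≠ r ∧ ∀ w, ¬ IsDescendant T r v w}

/-! ### Search orderings and first-in trees -/

/-- The vertex ordering `σ = (σ 0, …, σ (n - 1))` is a Generic Search ordering of `G`: every
vertex but the first one has a neighbor that is visited before it. -/
def IsGSOrdering (G : SimpleGraph V) {n : ℕ} (σ : Fin n ≃ V) : Prop :=
  ∀ i : Fin n, 0 < i.val → ∃ j : Fin n, j < i ∧ G.Adj (σ j) (σ i)

/-- Among all neighbors of `v` in `G`, the vertex `u` is leftmost in `σ`. -/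
def IsFirstNeighbor (G : SimpleGraph V) {n : ℕ} (σ : Fin n ≃ V) (u v : V) : Prop :=
  G.Adj v u ∧ ∀ w, G.Adj v w → σ.symm u ≤ σ.symm w

/-- The tree `T` rooted at `r` is the first-in tree (`F`-tree) of the vertex ordering `σ` of `G`:
it is a spanning tree, its root is the first vertex of `σ`, and the parent of every other vertex
is its neighbor in `G` that is leftmost in `σ`. -/
def IsFTree (G : SimpleGraph V) {n : ℕ} (σ : Fin n ≃ V) (T : SimpleGraph V) (r : V) : Prop :=
  IsSpanningTree G T ∧ (σ.symm r).val = 0 ∧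
    ∀ u v, v ≠ r → IsParent T r u v → IsFirstNeighbor G σ u v

end Trees

/-- The parameterized problem Max-Leaf F-Tree of Generic Search: given a connected non-empty graph
`G` and a parameter `k`, is there a Generic Search ordering of `G` whose F-tree has at least `k`
leaves? Strings that do not encode a connected non-empty graph are no-instances. -/
def maxLeafFTreeGS : ParamProblem :=
  {p | ∃ (n : ℕ) (G : SimpleGraph (Fin n)), p.1 = encodeGraph G ∧ G.Connected ∧
    ∃ (σ : Fin n ≃ Fin n) (T : SimpleGraph (Fin n)) (r : Fin n),
      IsGSOrdering G σ ∧ IsFTree G σ T r ∧ p.2 ≤ (leaves T r).ncard}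

/-! A rooted spanning tree with `k` leaves yields a connected set `C` of vertices, the ones that are
not leaves, with at least `k` neighbors. Conversely, a connected set with at least `k` neighbors can
be enlarged to a dominating one without losing neighbors; a Generic Search that visits this set
first has a first-in tree all of whose parents belong to the set, so that all other vertices are
leaves. Hence a connected graph is a yes-instance if and only if it has a connected vertex set with
at least `k` neighbors (`SimpleGraph.exists_isFTree_iff`).

The search for such a set is confined to a small part of the graph. In the neighborhood of a
smallest connected set with at least `k` neighbors, every vertex is adjacent to a vertex of degree
at least `3` (or at least `k`, which matters for small `k` only), because a vertex of degree at most
`2` in the set next to a neighbor of the set could be given up. These vertices are the candidates.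
If there are more than `k ^ 4` of them, then the answer is yes: unless some degree is at least `k`,
more than `k ^ 4` candidates force `k` vertices of degree at least `3` with disjoint closed
neighborhoods, and a connected set that absorbs these one after the other gains a neighbor each time
(`SimpleGraph.exists_connSet_of_disjoint`). Otherwise it suffices to try all sets `L` of candidates
together with all vertices `r`, and to count the neighbors of the set reached from `r` without
entering `L` (`SimpleGraph.exists_connSet_iff`). This takes `2 ^ k ^ 4` times a polynomial number of
steps.

The machine comes from a small language of structured programs on binary stacks, `StackCmd`, whose
programs are compiled to multi-stack Turing machines with the same running time
(`StackCmd.Run.outputs`). On top of it, `FP` is a predicate of polynomial-time functions between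
types of data kept on stacks; it is closed under composition and bounded recursion, and thus under
the arithmetic and the bounded quantifiers the algorithm is written with, so that `fun_prop`
establishes it for the algorithm. Running times are measured in an abstract size of the input, which
is only required to be at least its length. With the size `|x| + k + 1 + 2 ^ k ^ 4` of the instance
`(x, k)`, the polynomial bounds of `FP` are fixed-parameter tractable ones. -/

/-! ### Structured programs on stacks -/

/-- Structured programs acting on binary stacks indexed by natural numbers. -/
inductive StackCmd : Type
  | skip : StackCmd
  | push (r : ℕ) (b : Bool) : StackCmd
  | pop (r : ℕ) : StackCmd
  /-- Run `p` and then `q`. -/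
  | seq (p q : StackCmd) : StackCmd
  /-- Run `p` if the top of stack `r` is `true`, and `q` if it is `false` or missing. -/
  | ite (r : ℕ) (p q : StackCmd) : StackCmd
  /-- Run `p` as long as stack `r` is not empty. -/
  | loop (r : ℕ) (p : StackCmd) : StackCmd

namespace StackCmd

open Function Turing

/-- Sequential composition of programs. -/
scoped infixr:60 " ;; " => StackCmd.seq

/-- Big-step semantics: `Run p s t s'` says that `p`, started on the stacks `s`, ends on the
stacks `s'` after `t` steps. -/
inductive Run : StackCmd → (ℕ → List Bool) → ℕ → (ℕ → List Bool) → Prop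
  | skip (s) : Run skip s 1 s
  | push (s r b) : Run (push r b) s 1 (update s r (b :: s r))
  | pop (s r) : Run (pop r) s 1 (update s r (s r).tail)
  | seq {p q s t s' t' s''} : Run p s t s' → Run q s' t' s'' → Run (p ;; q) s (t + t') s''
  | ite_true {r p q s t s'} : (s r).head? = some true → Run p s t s' →
      Run (ite r p q) s (1 + t) s'
  | ite_false {r p q s t s'} : (s r).head? ≠ some true → Run q s t s' →
      Run (ite r p q) s (1 + t) s'
  | loop_nil {r p s} : s r = [] → Run (loop r p) s 1 s
  | loop_cons {r p s t s' t' s''} : s r ≠ [] → Run p s t s' → Run (loop r p) s' t' s'' →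
      Run (loop r p) s (1 + t + t') s''

/-- Control points of a program. -/
def Lab : StackCmd → Type
  | skip => Unit
  | push _ _ => Unit
  | pop _ => Unit
  | seq p q => Lab p ⊕ Lab q
  | ite _ p q => Option (Lab p ⊕ Lab q)
  | loop _ p => Option (Lab p)

instance Lab.fintype : (p : StackCmd) → Fintype p.Lab
  | skip => inferInstanceAs (Fintype Unit)
  | push _ _ => inferInstanceAs (Fintype Unit)
  | pop _ => inferInstanceAs (Fintype Unit)
  | seq p q =>
    letI := Lab.fintype p
    letI := Lab.fintype q
    inferInstanceAs (Fintype (Lab p ⊕ Lab q))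
  | ite _ p q =>
    letI := Lab.fintype p
    letI := Lab.fintype q
    inferInstanceAs (Fintype (Option (Lab p ⊕ Lab q)))
  | loop _ p =>
    letI := Lab.fintype p
    inferInstanceAs (Fintype (Option (Lab p)))

/-- The control point at which a program starts. -/
def entry : (p : StackCmd) → p.Lab
  | skip => ()
  | push _ _ => ()
  | pop _ => ()
  | seq p _ => Sum.inl p.entry
  | ite _ _ _ => none
  | loop _ _ => none

/-- The largest stack index used by a program. -/
def maxReg : StackCmd → ℕ
  | skip => 0
  | push r _ => r
  | pop r => r
  | seq p q => max p.maxReg q.maxReg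
  | ite r p q => max r (max p.maxReg q.maxReg)
  | loop r p => max r p.maxReg

/-- The stack of a machine with `m + 1` stacks that stands for stack `r` of a program. The value
for `r > m` is irrelevant. -/
def slot (m r : ℕ) : Fin (m + 1) := Fin.ofNat (m + 1) r

/-- The machine code of a program for a machine with `m + 1` stacks. The control points are
embedded by `e` in the labels of the machine, and control leaves the program through `x`. The
internal state of the machine holds the symbol read last and is `none` between two steps. -/
def stmt (m : ℕ) {Λ : Type} : (p : StackCmd) → (p.Lab → Λ) → Λ → p.Lab →
    TM2.Stmt (fun _ : Fin (m + 1) => Bool) Λ (Option Bool)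
  | skip, _, x, _ => .goto fun _ => x
  | push r b, _, x, _ => .push (slot m r) (fun _ => b) (.goto fun _ => x)
  | pop r, _, x, _ => .pop (slot m r) (fun v _ => v) (.goto fun _ => x)
  | seq p q, e, x, l =>
    match l with
    | .inl l => stmt m p (fun l => e (.inl l)) (e (.inr q.entry)) l
    | .inr l => stmt m q (fun l => e (.inr l)) x l
  | ite r p q, e, x, l =>
    match l with
    | none => .peek (slot m r) (fun _ o => o) <| .branch (fun v => v == some true)
        (.load (fun _ => none) (.goto fun _ => e (some (.inl p.entry))))
        (.load (fun _ => none) (.goto fun _ => e (some (.inr q.entry))))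
    | some (.inl l) => stmt m p (fun l => e (some (.inl l))) x l
    | some (.inr l) => stmt m q (fun l => e (some (.inr l))) x l
  | loop r p, e, x, l =>
    match l with
    | none => .peek (slot m r) (fun _ o => o) <| .branch Option.isSome
        (.load (fun _ => none) (.goto fun _ => e (some p.entry)))
        (.load (fun _ => none) (.goto fun _ => x))
    | some l => stmt m p (fun l => e (some l)) (e none) l

/-- The machine `M` gets from configuration `c` to configuration `c'` in `t` steps. -/
def Steps {K Λ σ : Type} [DecidableEq K] {Γ : K → Type} (M : Λ → TM2.Stmt Γ Λ σ) (t : ℕ)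
    (c c' : TM2.Cfg Γ Λ σ) : Prop :=
  (flip bind (TM2.step M))^[t] (some c) = some c'

theorem Steps.trans {K Λ σ : Type} [DecidableEq K] {Γ : K → Type} {M : Λ → TM2.Stmt Γ Λ σ}
    {t t' : ℕ} {c c' c'' : TM2.Cfg Γ Λ σ} (h : Steps M t c c') (h' : Steps M t' c' c'') :
    Steps M (t + t') c c'' := by
  unfold Steps at *
  rw [add_comm, Function.iterate_add_apply, h, h']

theorem Steps.one {K Λ σ : Type} [DecidableEq K] {Γ : K → Type} {M : Λ → TM2.Stmt Γ Λ σ}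
    {l : Λ} {v : σ} {S : ∀ k, List (Γ k)} {c : TM2.Cfg Γ Λ σ}
    (h : TM2.stepAux (M l) v S = c) : Steps M 1 ⟨some l, v, S⟩ c := by
  simp [Steps, flip, TM2.step, h]

/-- The first `m + 1` stacks. -/
def restrict (m : ℕ) (s : ℕ → List Bool) : Fin (m + 1) → List Bool := fun i => s i

theorem restrict_slot {m r : ℕ} (h : r ≤ m) (s : ℕ → List Bool) :
    restrict m s (slot m r) = s r := by
  simp [restrict, slot, Nat.mod_eq_of_lt (Nat.lt_succ_of_le h)]

theorem restrict_update {m r : ℕ} (h : r ≤ m) (s : ℕ → List Bool) (v : List Bool) :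
    update (restrict m s) (slot m r) v = restrict m (update s r v) := by
  funext i
  simp only [restrict, slot, update_apply, Fin.ext_iff, Fin.val_ofNat,
    Nat.mod_eq_of_lt (Nat.lt_succ_of_le h)]

/-- A machine that contains the code of `p` simulates the runs of `p`. -/
theorem Run.steps {m : ℕ} {Λ : Type}
    {M : Λ → TM2.Stmt (fun _ : Fin (m + 1) => Bool) Λ (Option Bool)} {p : StackCmd}
    {s s' : ℕ → List Bool} {t : ℕ} (h : Run p s t s') (hm : p.maxReg ≤ m) (e : p.Lab → Λ) (x : Λ)
    (hM : ∀ l, M (e l) = stmt m p e x l) :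
    Steps M t ⟨some (e p.entry), none, restrict m s⟩ ⟨some x, none, restrict m s'⟩ := by
  induction h generalizing x with
  | skip s => exact Steps.one (by rw [hM]; rfl)
  | push s r b =>
    replace hm : r ≤ m := hm
    refine Steps.one ?_
    rw [hM]
    simp [stmt, restrict_slot hm, restrict_update hm]
  | pop s r =>
    replace hm : r ≤ m := hm
    refine Steps.one ?_
    rw [hM]
    simp [stmt, restrict_slot hm, restrict_update hm]
  | @seq p q s t s' t' s'' _ _ ih ih' =>
    simp only [maxReg, max_le_iff] at hm
    exact (ih hm.1 (fun l => e (.inl l)) (e (.inr q.entry)) fun l => hM (.inl l)).trans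
      (ih' hm.2 (fun l => e (.inr l)) x fun l => hM (.inr l))
  | @ite_true r p q s t s' hr _ ih =>
    simp only [maxReg, max_le_iff] at hm
    refine Steps.trans (Steps.one ?_)
      (ih hm.2.1 (fun l => e (some (.inl l))) x fun l => hM (some (.inl l)))
    rw [hM]
    simp [stmt, entry, restrict_slot hm.1, hr]
  | @ite_false r p q s t s' hr _ ih =>
    simp only [maxReg, max_le_iff] at hm
    refine Steps.trans (Steps.one ?_)
      (ih hm.2.2 (fun l => e (some (.inr l))) x fun l => hM (some (.inr l)))
    rw [hM]
    have : ((s r).head? == some true) = false := by simpa using hr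
    simp [stmt, entry, restrict_slot hm.1, this]
  | @loop_nil r p s hr =>
    simp only [maxReg, max_le_iff] at hm
    refine Steps.one ?_
    rw [hM]
    simp [stmt, entry, restrict_slot hm.1, hr]
  | @loop_cons r p s t s' t' s'' hr _ _ ih ih' =>
    have hm' := hm
    simp only [maxReg, max_le_iff] at hm
    refine Steps.trans (Steps.trans (Steps.one ?_)
      (ih hm.2 (fun l => e (some l)) (e none) fun l => hM (some l))) (ih' hm' e x hM)
    rw [hM]
    have : (s r).head?.isSome = true := by
      cases h : s r with
      | nil => exact absurd h hr
      | cons => rfl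
    simp [stmt, entry, restrict_slot hm.1, this]

/-- The Turing machine of a program, with input stack `0` and output stack `1`. -/
def machine (p : StackCmd) : FinTM2 where
  K := Fin (p.maxReg + 1 + 1)
  k₀ := 0
  k₁ := 1
  Γ _ := Bool
  Λ := Option p.Lab
  main := some p.entry
  σ := Option Bool
  initialState := none
  Γk₀Fin := inferInstanceAs (Fintype Bool)
  m
    | none => .halt
    | some l => stmt (p.maxReg + 1) p some none l

/-- A program that turns a single stack into a single stack gives a machine that does so. -/
theorem Run.outputs {p : StackCmd} {t : ℕ} {u v : List Bool}
    (h : Run p (update (fun _ => []) 0 u) t (update (fun _ => []) 1 v)) {T : ℕ} (hT : t + 1 ≤ T) :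
    Nonempty (TM2OutputsInTime p.machine u (some v) T) := by
  have h1 := h.steps (M := p.machine.m) (Nat.le_succ _) some none fun _ => rfl
  have h2 : Steps p.machine.m 1
      ⟨some none, none, restrict (p.maxReg + 1) (update (fun _ => []) 1 v)⟩
      ⟨none, none, restrict (p.maxReg + 1) (update (fun _ => []) 1 v)⟩ := Steps.one rfl
  refine ⟨⟨⟨t + 1, ?_⟩, hT⟩⟩
  have h3 := h1.trans h2
  have hi : initList p.machine u
      = ⟨some (some p.entry), none, restrict (p.maxReg + 1) (update (fun _ => []) 0 u)⟩ := by
    simp only [initList]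
    congr 1
    rw [← restrict_update (by omega)]
    funext k
    by_cases hk : k = (0 : Fin (p.maxReg + 1 + 1))
    · subst hk; rfl
    · exact (dif_neg hk).trans (update_of_ne (f := restrict _ fun _ => []) hk _).symm
  have ho : haltList p.machine v
      = ⟨none, none, restrict (p.maxReg + 1) (update (fun _ => []) 1 v)⟩ := by
    simp only [haltList]
    congr 1
    rw [← restrict_update (by omega)]
    funext k
    by_cases hk : k = (1 : Fin (p.maxReg + 1 + 1))
    · subst hk; rfl
    · exact (dif_neg hk).trans (update_of_ne (f := restrict _ fun _ => []) hk _).symm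
  rw [hi]
  refine Eq.trans h3 ?_
  rw [← ho]
  rfl

end StackCmd

/-! ### Basic programs -/

namespace StackCmd

open Function

theorem Run.cast {p : StackCmd} {s t s' t' s''} (h : Run p s t s') (ht : t = t') (hs : s' = s'') :
    Run p s t' s'' := ht ▸ hs ▸ h

/-- Every step pushes at most one symbol. -/
theorem Run.length_le {p : StackCmd} {s t s'} (h : Run p s t s') (r : ℕ) :
    (s' r).length ≤ (s r).length + t := by
  induction h with
  | skip => omega
  | push s r' b =>
    by_cases hr : r = r'
    · subst hr; simp
    · simp [update_of_ne hr]
  | pop s r' =>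
    by_cases hr : r = r'
    · subst hr; simp; omega
    · simp [update_of_ne hr]
  | loop_nil => omega
  | _ => omega

/-- Renaming of the stacks of a program. -/
def rename (ρ : ℕ → ℕ) : StackCmd → StackCmd
  | skip => skip
  | push r b => push (ρ r) b
  | pop r => pop (ρ r)
  | seq p q => seq (p.rename ρ) (q.rename ρ)
  | ite r p q => ite (ρ r) (p.rename ρ) (q.rename ρ)
  | loop r p => loop (ρ r) (p.rename ρ)

theorem update_comp_of_injective {ρ : ℕ → ℕ} (hρ : Injective ρ) (S : ℕ → List Bool) (r : ℕ)
    (v : List Bool) : update S (ρ r) v ∘ ρ = update (S ∘ ρ) r v := by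
  funext i
  simp [update_apply, hρ.eq_iff]

theorem Run.rename {ρ : ℕ → ℕ} (hρ : Injective ρ) {p : StackCmd} {s t s'} (h : Run p s t s')
    {S : ℕ → List Bool} (hS : S ∘ ρ = s) :
    ∃ S', Run (p.rename ρ) S t S' ∧ S' ∘ ρ = s' ∧ ∀ r ∉ Set.range ρ, S' r = S r := by
  induction h generalizing S with
  | skip s => exact ⟨S, .skip S, hS, fun _ _ => rfl⟩
  | push s r b =>
    refine ⟨_, .push S (ρ r) b, ?_, fun i hi => update_of_ne (fun h => hi ⟨r, h.symm⟩) _ _⟩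
    rw [update_comp_of_injective hρ, hS, ← hS]
    rfl
  | pop s r =>
    refine ⟨_, .pop S (ρ r), ?_, fun i hi => update_of_ne (fun h => hi ⟨r, h.symm⟩) _ _⟩
    rw [update_comp_of_injective hρ, hS, ← hS]
    rfl
  | seq _ _ ih ih' =>
    obtain ⟨S₁, h₁, h₁', h₁''⟩ := ih hS
    obtain ⟨S₂, h₂, h₂', h₂''⟩ := ih' h₁'
    exact ⟨S₂, .seq h₁ h₂, h₂', fun r hr => (h₂'' r hr).trans (h₁'' r hr)⟩
  | ite_true hr _ ih =>
    obtain ⟨S₁, h₁, h₁'⟩ := ih hS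
    exact ⟨S₁, .ite_true (by rw [← hr, ← hS]; rfl) h₁, h₁'⟩
  | ite_false hr _ ih =>
    obtain ⟨S₁, h₁, h₁'⟩ := ih hS
    refine ⟨S₁, .ite_false (fun h => hr ?_) h₁, h₁'⟩
    rw [← h, ← hS]; rfl
  | loop_nil hr => exact ⟨S, .loop_nil (by rw [← hr, ← hS]; rfl), hS, fun _ _ => rfl⟩
  | loop_cons hr _ _ ih ih' =>
    obtain ⟨S₁, h₁, h₁', h₁''⟩ := ih hS
    obtain ⟨S₂, h₂, h₂', h₂''⟩ := ih' h₁'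
    refine ⟨S₂, .loop_cons (fun h => hr ?_) h₁ h₂, h₂', fun r hr => (h₂'' r hr).trans (h₁'' r hr)⟩
    rw [← h, ← hS]; rfl

theorem Run.rename_update {ρ : ℕ → ℕ} (hρ : Injective ρ) {p : StackCmd} {s t r v}
    (h : Run p s t (update s r v)) {S : ℕ → List Bool} (hS : S ∘ ρ = s) :
    Run (p.rename ρ) S t (update S (ρ r) v) := by
  obtain ⟨S', h1, h2, h3⟩ := h.rename hρ hS
  refine h1.cast rfl ?_
  funext i
  by_cases hi : i ∈ Set.range ρ
  · obtain ⟨j, rfl⟩ := hi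
    rw [← hS, ← update_comp_of_injective hρ] at h2
    exact congrFun h2 j
  · rw [h3 i hi, update_of_ne (fun h => hi ⟨r, h.symm⟩)]

/-- Empty stack `r`. -/
def clear (r : ℕ) : StackCmd := loop r (pop r)

theorem run_clear (s : ℕ → List Bool) (r : ℕ) :
    Run (clear r) s (2 * (s r).length + 1) (update s r []) := by
  generalize h : s r = l
  induction l generalizing s with
  | nil => exact (Run.loop_nil h).cast (by simp) (by rw [← h, update_eq_self])
  | cons b l ih =>
    refine (Run.loop_cons (by simp [h]) (.pop s r) (ih _ (by simp [h]))).cast ?_ (by simp)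
    simp; ring

/-- Move the content of stack `r` onto stack `r'`, reversing it. -/
def moveRev (r r' : ℕ) : StackCmd :=
  loop r (ite r (push r' true ;; pop r) (push r' false ;; pop r))

theorem run_moveRev (s : ℕ → List Bool) {r r' : ℕ} (hr : r ≠ r') :
    Run (moveRev r r') s (4 * (s r).length + 1)
      (update (update s r []) r' ((s r).reverse ++ s r')) := by
  generalize h : s r = l
  induction l generalizing s with
  | nil =>
    refine (Run.loop_nil h).cast (by simp) ?_
    simp only [List.reverse_nil, List.nil_append]
    rw [← h, update_eq_self, update_eq_self]
  | cons b l ih =>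
    have h1 : Run (ite r (push r' true ;; pop r) (push r' false ;; pop r)) s 3
        (update (update s r' (b :: s r')) r l) := by
      cases b
      · refine (Run.ite_false (by simp [h]) (.seq (.push s r' false) (.pop _ r))).cast (by simp) ?_
        simp [update_of_ne hr, h]
      · refine (Run.ite_true (by simp [h]) (.seq (.push s r' true) (.pop _ r))).cast (by simp) ?_
        simp [update_of_ne hr, h]
    refine (Run.loop_cons (by simp [h]) h1 (ih _ (by simp))).cast ?_ ?_
    · simp; ring
    · funext i
      simp only [update_apply, List.reverse_cons, List.append_assoc, List.singleton_append]
      split_ifs <;> simp_all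

/-- Move the content of stack `r` onto stack `r'`, using the empty stack `tmp`. -/
def move (r r' tmp : ℕ) : StackCmd := moveRev r tmp ;; moveRev tmp r'

theorem run_move (s : ℕ → List Bool) {r r' tmp : ℕ} (h1 : r ≠ r') (h2 : r ≠ tmp) (h3 : r' ≠ tmp)
    (h : s tmp = []) :
    Run (move r r' tmp) s (8 * (s r).length + 2)
      (update (update s r []) r' (s r ++ s r')) := by
  refine (Run.seq (run_moveRev s h2) (run_moveRev _ h3.symm)).cast ?_ ?_
  · simp [h]; ring
  · funext i
    simp only [update_apply]
    split_ifs <;> simp_all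

/-- Copy the content of stack `r` onto stack `r'`, using the empty stack `tmp`. -/
def copy (r r' tmp : ℕ) : StackCmd :=
  moveRev r tmp ;; loop tmp (ite tmp (push r true ;; push r' true ;; pop tmp)
    (push r false ;; push r' false ;; pop tmp))

theorem run_copy (s : ℕ → List Bool) {r r' tmp : ℕ} (h1 : r ≠ r') (h2 : r ≠ tmp) (h3 : r' ≠ tmp)
    (h : s tmp = []) :
    Run (copy r r' tmp) s (9 * (s r).length + 2) (update s r' (s r ++ s r')) := by
  have key : ∀ (l : List Bool) (s : ℕ → List Bool), s tmp = l →
      Run (loop tmp (ite tmp (push r true ;; push r' true ;; pop tmp)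
        (push r false ;; push r' false ;; pop tmp))) s (5 * l.length + 1)
      (update (update (update s r (l.reverse ++ s r)) r' (l.reverse ++ s r')) tmp []) := by
    intro l
    induction l with
    | nil =>
      intro s h
      refine (Run.loop_nil h).cast (by simp) ?_
      funext i
      simp only [update_apply]
      split_ifs <;> simp_all
    | cons b l ih =>
      intro s h
      have h1 : Run (ite tmp (push r true ;; push r' true ;; pop tmp)
          (push r false ;; push r' false ;; pop tmp)) s 4
          (update (update (update s r (b :: s r)) r' (b :: s r')) tmp l) := by
        cases b
        · refine (Run.ite_false (by simp [h])
            (.seq (.push s r false) (.seq (.push _ r' false) (.pop _ tmp)))).cast (by simp) ?_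
          simp [update_of_ne h1.symm, update_of_ne h2.symm, update_of_ne h3.symm, h]
        · refine (Run.ite_true (by simp [h])
            (.seq (.push s r true) (.seq (.push _ r' true) (.pop _ tmp)))).cast (by simp) ?_
          simp [update_of_ne h1.symm, update_of_ne h2.symm, update_of_ne h3.symm, h]
      refine (Run.loop_cons (by simp [h]) h1 (ih _ (by simp))).cast ?_ ?_
      · simp; ring
      · funext i
        simp only [update_apply, List.reverse_cons, List.append_assoc, List.singleton_append]
        split_ifs <;> simp_all
  refine (Run.seq (run_moveRev s h2) (key _ _ rfl)).cast ?_ ?_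
  · simp [h]; ring
  · funext i
    simp only [update_apply]
    split_ifs <;> simp_all

end StackCmd

/-! ### Polynomial bounds -/

/-- `F` is bounded by a polynomial in `sz`. As `sz a + 2 ≥ 2`, powers of it majorize all
polynomials in `sz a`. -/
def PolyBdd {α : Type} (sz F : α → ℕ) : Prop := ∃ c, ∀ a, F a ≤ (sz a + 2) ^ c

namespace PolyBdd

variable {α β : Type} {sz F G : α → ℕ}

theorem mono (hG : PolyBdd sz G) (h : ∀ a, F a ≤ G a) : PolyBdd sz F :=
  hG.imp fun _ hc a => (h a).trans (hc a)

theorem self : PolyBdd sz sz := ⟨1, fun a => by simp⟩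

theorem const (k : ℕ) : PolyBdd sz fun _ => k :=
  ⟨k, fun a => (Nat.lt_two_pow_self).le.trans (Nat.pow_le_pow_left (by omega) k)⟩

theorem mul (hF : PolyBdd sz F) (hG : PolyBdd sz G) : PolyBdd sz fun a => F a * G a := by
  obtain ⟨c, hc⟩ := hF
  obtain ⟨d, hd⟩ := hG
  exact ⟨c + d, fun a => (Nat.mul_le_mul (hc a) (hd a)).trans_eq (pow_add _ _ _).symm⟩

theorem add (hF : PolyBdd sz F) (hG : PolyBdd sz G) : PolyBdd sz fun a => F a + G a := by
  obtain ⟨c, hc⟩ := hF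
  obtain ⟨d, hd⟩ := hG
  refine ⟨max c d + 1, fun a => ?_⟩
  have h1 := (hc a).trans (Nat.pow_le_pow_right (by omega : 0 < sz a + 2) (le_max_left c d))
  have h2 := (hd a).trans (Nat.pow_le_pow_right (by omega : 0 < sz a + 2) (le_max_right c d))
  rw [pow_succ]
  nlinarith [Nat.zero_le (sz a * (sz a + 2) ^ max c d)]

theorem pow (hF : PolyBdd sz F) (k : ℕ) : PolyBdd sz fun a => F a ^ k := by
  obtain ⟨c, hc⟩ := hF
  exact ⟨c * k, fun a => (Nat.pow_le_pow_left (hc a) k).trans_eq (pow_mul _ _ _).symm⟩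

theorem comp {sz' : β → ℕ} {F : β → ℕ} {g : α → β} (hF : PolyBdd sz' F)
    (hg : PolyBdd sz fun a => sz' (g a)) : PolyBdd sz fun a => F (g a) := by
  obtain ⟨c, hc⟩ := hF
  exact ((hg.add (const 2)).pow c).mono fun a => hc (g a)

end PolyBdd

/-! ### Polynomial-time functions of a tuple of strings -/

open StackCmd Function

/-- The stacks holding, in this order, the values at `a` of the functions in `rs`; the other
stacks are empty. -/
def load {α : Type} (rs : List (α → List Bool)) (a : α) : ℕ → List Bool :=
  fun i => (rs.map fun f => f a).getD i []

/-- `f a` is computed, from the values at `a` of the functions in `rs`, by a program whose running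
time is polynomial in `sz a`. The program writes the result on the first free stack, and restores
all the others. -/
def FPL {α : Type} (sz : α → ℕ) (rs : List (α → List Bool)) (f : α → List Bool) : Prop :=
  ∃ (p : StackCmd) (T : α → ℕ), PolyBdd sz T ∧
    ∀ a, ∃ t ≤ T a, Run p (load rs a) t (update (load rs a) rs.length (f a))

section load

variable {α β : Type} {rs rs' : List (α → List Bool)}

theorem load_of_le {a : α} {i : ℕ} (h : rs.length ≤ i) : load rs a i = [] :=
  List.getD_eq_default _ _ (by simpa using h)

theorem load_append_left {a : α} {i : ℕ} (h : i < rs.length) :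
    load (rs ++ rs') a i = load rs a i := by
  simp only [load, List.map_append]
  rw [List.getD_append _ _ _ _ (by simpa using h)]

theorem load_append_right {a : α} {i : ℕ} (h : rs.length ≤ i) :
    load (rs ++ rs') a i = load rs' a (i - rs.length) := by
  simp only [load, List.map_append]
  rw [List.getD_append_right _ _ _ _ (by simpa using h)]
  simp

theorem load_append_singleton (h : α → List Bool) (a : α) :
    load (rs ++ [h]) a = update (load rs a) rs.length (h a) := by
  funext i
  rcases lt_trichotomy i rs.length with hi | rfl | hi
  · rw [load_append_left hi, update_of_ne hi.ne]
  · rw [load_append_right le_rfl]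
    simp [load]
  · rw [load_append_right hi.le, update_of_ne hi.ne', load_of_le hi.le]
    exact load_of_le (by simp; omega)

theorem load_map_comp {rs : List (β → List Bool)} (g : α → β) (a : α) :
    load (rs.map fun f => f ∘ g) a = load rs (g a) := by
  funext i
  simp only [load, List.map_map]
  rfl

end load

/-- The renaming of stacks that makes room for `e` stacks in front of stack `m`. -/
def makeRoom (m e r : ℕ) : ℕ := if r < m then r else r + e

theorem makeRoom_injective (m e : ℕ) : Injective (makeRoom m e) := by
  intro a b h
  simp only [makeRoom] at h
  split_ifs at h <;> omega

namespace FPL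

variable {α β : Type} {sz : α → ℕ} {rs rs' : List (α → List Bool)} {f g h : α → List Bool}

theorem of_eq (hf : FPL sz rs f) (h : ∀ a, f a = g a) : FPL sz rs g :=
  (funext h : f = g) ▸ hf

theorem polyBdd (hf : FPL sz rs f) : PolyBdd sz fun a => (f a).length := by
  obtain ⟨p, T, hT, hp⟩ := hf
  refine hT.mono fun a => ?_
  obtain ⟨t, ht, hr⟩ := hp a
  have := hr.length_le rs.length
  rw [update_self, load_of_le le_rfl] at this
  simp at this
  omega

theorem renamed {ρ : ℕ → ℕ} (hf : FPL sz rs f) (hρ : Injective ρ)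
    (h : ∀ a, load rs' a ∘ ρ = load rs a) (hl : ρ rs.length = rs'.length) : FPL sz rs' f := by
  obtain ⟨p, T, hT, hp⟩ := hf
  refine ⟨p.rename ρ, T, hT, fun a => ?_⟩
  obtain ⟨t, ht, hr⟩ := hp a
  exact ⟨t, ht, hl ▸ hr.rename_update hρ (h a)⟩

theorem append_right (hf : FPL sz rs f) (rs' : List (α → List Bool)) : FPL sz (rs ++ rs') f := by
  refine hf.renamed (makeRoom_injective rs.length rs'.length) (fun a => ?_) (by simp [makeRoom])
  funext i
  simp only [comp_apply, makeRoom]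
  split_ifs with hi
  · exact load_append_left hi
  · rw [load_of_le (by simp; omega), load_of_le (by omega)]

theorem append_left (hf : FPL sz rs f) (rs' : List (α → List Bool)) : FPL sz (rs' ++ rs) f := by
  refine hf.renamed (ρ := fun r => r + rs'.length) (add_left_injective _) (fun a => ?_)
    (by simp [add_comm])
  funext i
  simp only [comp_apply]
  rw [load_append_right (by omega), Nat.add_sub_cancel]

/-- Local definition: an intermediate result may be used like an argument. -/
theorem let_in (hf : FPL sz (rs ++ [h]) f) (hh : FPL sz rs h) : FPL sz rs f := by
  have hb := hh.polyBdd
  have hb' := hf.polyBdd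
  obtain ⟨p, T, hT, hp⟩ := hf
  obtain ⟨q, U, hU, hq⟩ := hh
  obtain ⟨m, hm⟩ : ∃ m, rs.length = m := ⟨_, rfl⟩
  unfold FPL
  simp only [hm] at hq ⊢
  refine ⟨q ;; p ;; clear m ;; move (m + 1) m (m + 2),
    fun a => U a + (T a + ((2 * (h a).length + 1) + (8 * (f a).length + 2))),
    hU.add (hT.add ((((PolyBdd.const 2).mul hb).add (.const 1)).add
      (((PolyBdd.const 8).mul hb').add (.const 2)))), fun a => ?_⟩
  obtain ⟨t, ht, hr⟩ := hp a
  obtain ⟨u, hu, hr'⟩ := hq a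
  rw [load_append_singleton] at hr
  simp only [List.length_append, List.length_singleton] at hr
  rw [hm] at hr
  refine ⟨_, ?_, (hr'.seq (hr.seq ((run_clear _ m).seq
    (run_move _ (r := m + 1) (r' := m) (tmp := m + 2) (by omega) (by omega) (by omega) ?_)))).cast
      rfl ?_⟩
  · simp
    omega
  · simp [load_of_le (rs := rs) (show rs.length ≤ m + 2 by omega)]
  · funext i
    simp only [update_apply]
    split_ifs <;> simp_all [load_of_le]

/-- Substitution of intermediate results for all the arguments. -/
theorem subst (hf : FPL sz rs' f) (h : ∀ c ∈ rs', FPL sz rs c) : FPL sz rs f := by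
  replace hf := hf.append_left rs
  induction rs' using List.reverseRecOn with
  | nil => simpa using hf
  | append_singleton l c ih =>
    rw [← List.append_assoc] at hf
    exact ih (fun c hc => h c (by simp [hc])) (hf.let_in ((h c (by simp)).append_right l))

theorem comp {sz' : β → ℕ} {rs : List (β → List Bool)} {f : β → List Bool} (hf : FPL sz' rs f)
    {g : α → β} (hg : PolyBdd sz fun a => sz' (g a)) :
    FPL sz (rs.map fun c => c ∘ g) (f ∘ g) := by
  obtain ⟨p, T, hT, hp⟩ := hf
  refine ⟨p, fun a => T (g a), hT.comp hg, fun a => ?_⟩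
  rw [load_map_comp]
  simpa using hp (g a)

theorem var (hc : h ∈ rs) (hb : PolyBdd sz fun a => (h a).length) : FPL sz rs h := by
  obtain ⟨i, hi, rfl⟩ := List.getElem_of_mem hc
  refine ⟨copy i rs.length (rs.length + 1), fun a => 9 * (rs[i] a).length + 2,
    ((PolyBdd.const 9).mul hb).add (.const 2), fun a => ?_⟩
  have h1 : load rs a i = rs[i] a := by simp [load, hi]
  refine ⟨_, le_rfl, (run_copy _ (by omega) (by omega) (by omega) (load_of_le (by omega))).cast
    (by rw [h1]) ?_⟩
  rw [h1, load_of_le le_rfl, List.append_nil]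

theorem nil : FPL sz rs fun _ => [] :=
  ⟨.skip, fun _ => 1, .const 1, fun a => ⟨1, le_rfl, (Run.skip _).cast rfl (by
    rw [← load_of_le (rs := rs) (a := a) le_rfl, update_eq_self])⟩⟩

theorem cons (hf : FPL sz rs f) (b : Bool) : FPL sz rs fun a => b :: f a := by
  obtain ⟨p, T, hT, hp⟩ := hf
  refine ⟨p ;; push rs.length b, fun a => T a + 1, hT.add (.const 1), fun a => ?_⟩
  obtain ⟨t, ht, hr⟩ := hp a
  exact ⟨t + 1, by beta_reduce; omega, (hr.seq (.push _ _ _)).cast rfl (by simp)⟩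

theorem tail (hf : FPL sz rs f) : FPL sz rs fun a => (f a).tail := by
  obtain ⟨p, T, hT, hp⟩ := hf
  refine ⟨p ;; pop rs.length, fun a => T a + 1, hT.add (.const 1), fun a => ?_⟩
  obtain ⟨t, ht, hr⟩ := hp a
  exact ⟨t + 1, by beta_reduce; omega, (hr.seq (.pop _ _)).cast rfl (by simp)⟩

theorem head (hf : FPL sz rs f) : FPL sz rs fun a => [(f a).headD false] := by
  have hb := hf.polyBdd
  obtain ⟨p, T, hT, hp⟩ := hf
  obtain ⟨m, hm⟩ : ∃ m, rs.length = m := ⟨_, rfl⟩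
  unfold FPL
  simp only [hm] at hp ⊢
  refine ⟨p ;; ite m (clear m ;; push m true) (clear m ;; push m false),
    fun a => T a + (1 + ((2 * (f a).length + 1) + 1)),
    hT.add ((PolyBdd.const 1).add ((((PolyBdd.const 2).mul hb).add (.const 1)).add (.const 1))),
    fun a => ?_⟩
  obtain ⟨t, ht, hr⟩ := hp a
  by_cases hc : (f a).head? = some true
  · refine ⟨_, ?_, (hr.seq (.ite_true (by simpa using hc)
      (.seq (run_clear _ m) (.push _ m true)))).cast rfl ?_⟩
    · simp; omega
    · cases h : f a <;> simp_all
  · refine ⟨_, ?_, (hr.seq (.ite_false (by simpa using hc)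
      (.seq (run_clear _ m) (.push _ m false)))).cast rfl ?_⟩
    · simp; omega
    · cases h : f a <;> simp_all

theorem append (hf : FPL sz rs f) (hg : FPL sz rs g) : FPL sz rs fun a => f a ++ g a := by
  replace hf := hf.append_right [g]
  have hb := hf.polyBdd
  obtain ⟨p, T, hT, hp⟩ := hf
  obtain ⟨q, U, hU, hq⟩ := hg
  obtain ⟨m, hm⟩ : ∃ m, rs.length = m := ⟨_, rfl⟩
  unfold FPL
  simp only [hm] at hq ⊢
  refine ⟨q ;; p ;; move (m + 1) m (m + 2),
    fun a => U a + (T a + (8 * (f a).length + 2)),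
    hU.add (hT.add (((PolyBdd.const 8).mul hb).add (.const 2))), fun a => ?_⟩
  obtain ⟨t, ht, hr⟩ := hp a
  obtain ⟨u, hu, hr'⟩ := hq a
  rw [load_append_singleton] at hr
  simp only [List.length_append, List.length_singleton] at hr
  rw [hm] at hr
  refine ⟨_, ?_, (hr'.seq (hr.seq
    (run_move _ (r := m + 1) (r' := m) (tmp := m + 2) (by omega) (by omega) (by omega) ?_))).cast
      rfl ?_⟩
  · simp
    omega
  · simp [load_of_le (rs := rs) (show rs.length ≤ m + 2 by omega)]
  · funext i
    by_cases h1 : i = m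
    · subst h1
      simp
    · by_cases h2 : i = m + 1
      · subst h2
        simp [load_of_le (rs := rs) (show rs.length ≤ m + 1 by omega)]
      · simp [update_of_ne h1, update_of_ne h2]

theorem ite {c : α → Bool} (hc : FPL sz rs fun a => [c a]) (hf : FPL sz rs f) (hg : FPL sz rs g) :
    FPL sz rs fun a => if c a then f a else g a := by
  obtain ⟨r, V, hV, hr⟩ := hc
  obtain ⟨p, T, hT, hp⟩ := hf
  obtain ⟨q, U, hU, hq⟩ := hg
  obtain ⟨m, hm⟩ : ∃ m, rs.length = m := ⟨_, rfl⟩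
  unfold FPL
  simp only [hm] at hr hp hq ⊢
  refine ⟨r ;; .ite m (pop m ;; p) (pop m ;; q), fun a => V a + (1 + (1 + (T a + U a))),
    hV.add ((PolyBdd.const 1).add ((PolyBdd.const 1).add (hT.add hU))), fun a => ?_⟩
  obtain ⟨v, hv, hr⟩ := hr a
  obtain ⟨t, ht, hp⟩ := hp a
  obtain ⟨u, hu, hq⟩ := hq a
  have h0 : update (update (load rs a) m [c a]) m (update (load rs a) m [c a] m).tail
      = load rs a := by
    simp [← load_of_le (rs := rs) (a := a) hm.le]
  by_cases h : c a
  · have h1 := Run.pop (update (load rs a) m [c a]) m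
    rw [h0] at h1
    exact ⟨_, by beta_reduce; omega, (hr.seq (.ite_true (by simp [h]) (h1.seq hp))).cast rfl
      (by simp [h])⟩
  · have h1 := Run.pop (update (load rs a) m [c a]) m
    rw [h0] at h1
    exact ⟨_, by beta_reduce; omega, (hr.seq (.ite_false (by simp [h]) (h1.seq hq))).cast rfl
      (by simp [h])⟩

/-- Bounded recursion: the length of the list `l a` is the number of rounds, and the step function
sees the arguments, the index of the round, in unary, and the result of the previous round. -/
theorem natRec {l z : α → List Bool} {g : α → ℕ → List Bool → List Bool}
    (hl : FPL sz rs l) (hz : FPL sz rs z)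
    (hg : FPL (fun q : α × ℕ × List Bool => sz q.1 + (q.2.1 + q.2.2.length))
      (rs.map (fun c => c ∘ Prod.fst) ++ [fun q => List.replicate q.2.1 true] ++ [fun q => q.2.2])
      fun q => g q.1 q.2.1 q.2.2)
    {B : α → ℕ} (hB : PolyBdd sz B)
    (hb : ∀ a, ∀ i ≤ (l a).length,
      (Nat.rec (z a) (g a) i : List Bool).length ≤ B a) :
    FPL sz rs fun a => (Nat.rec (z a) (g a) (l a).length : List Bool) := by
  have hl' := hl.polyBdd
  have hz' := hz.append_right [l, fun _ => []]
  obtain ⟨pl, Tl, hTl, hpl⟩ := hl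
  obtain ⟨pz, Tz, hTz, hpz⟩ := hz'
  obtain ⟨pg, Tg, ⟨c, hTg⟩, hpg⟩ := hg
  obtain ⟨m, hm⟩ : ∃ m, rs.length = m := ⟨_, rfl⟩
  unfold FPL
  simp only [hm] at hpl ⊢
  -- Stack `m` holds as many symbols as rounds are left, stack `m + 1` the index of the round, and
  -- stack `m + 2` the result of the previous round. The step function, whose arguments do not
  -- include the rounds left, writes on stack `m + 3`.
  set body := pop m ;; pg.rename (makeRoom m 1) ;; clear (m + 2) ;; move (m + 3) (m + 2) (m + 4) ;;
    push (m + 1) true with hbody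
  let K : α → ℕ := fun a => (sz a + ((l a).length + B a) + 2) ^ c + 10 * B a + 6
  have hK : PolyBdd sz K := by
    refine PolyBdd.add (PolyBdd.add ?_ ((PolyBdd.const 10).mul hB)) (.const 6)
    exact ((PolyBdd.self.add (hl'.add hB)).add (.const 2)).pow c
  have step : ∀ (a : α) (L : List Bool) (i : ℕ), i + L.length = (l a).length →
      ∃ t ≤ L.length * K a + 1, Run (loop m body)
        (update (update (update (load rs a) m L) (m + 1) (List.replicate i true)) (m + 2)
          (Nat.rec (z a) (g a) i)) t
        (update (update (load rs a) (m + 1) (List.replicate (l a).length true)) (m + 2)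
          (Nat.rec (z a) (g a) (l a).length)) := by
    intro a L
    induction L with
    | nil =>
      intro i hi
      simp only [List.length_nil, add_zero] at hi
      subst hi
      refine ⟨1, by simp, (Run.loop_nil ?_).cast rfl ?_⟩
      · simp
      · rw [show update (load rs a) m [] = load rs a by
          rw [← load_of_le (rs := rs) (a := a) hm.le, update_eq_self]]
    | cons b L ih =>
      intro i hi
      simp only [List.length_cons] at hi ⊢
      set acc : List Bool := Nat.rec (z a) (g a) i with hacc
      have hacc' : (Nat.rec (z a) (g a) (i + 1) : List Bool) = g a i acc := rfl
      obtain ⟨t, ht, hr⟩ := hpg (a, i, acc)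
      obtain ⟨u, hu, hr'⟩ := ih (i + 1) (by omega)
      have hb1 := hb a i (by omega)
      have hb2 := hb a (i + 1) (by omega)
      rw [hacc'] at hr' hb2
      rw [← hacc] at hb1
      rw [load_append_singleton, load_append_singleton, load_map_comp] at hr
      simp only [List.length_append, List.length_map, List.length_singleton] at hr
      rw [hm] at hr
      have h1 := hr.rename_update (makeRoom_injective m 1)
        (S := update (update (update (load rs a) m L) (m + 1) (List.replicate i true))
          (m + 2) acc) (by
          funext r
          simp only [comp_apply, makeRoom, update_apply]
          split_ifs <;> first | omega | rfl | (rw [load_of_le (by omega), load_of_le (by omega)]))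
      have hroom : makeRoom m 1 (m + 1 + 1) = m + 3 := if_neg (by omega)
      rw [hroom] at h1
      have h2 : Run body (update (update (update (load rs a) m (b :: L)) (m + 1)
          (List.replicate i true)) (m + 2) acc)
          (1 + (t + ((2 * acc.length + 1) + ((8 * (g a i acc).length + 2) + 1))))
          (update (update (update (load rs a) m L) (m + 1) (List.replicate (i + 1) true)) (m + 2)
            (g a i acc)) := by
        refine ((Run.pop _ m).cast rfl ?_).seq (h1.seq (((run_clear _ (m + 2)).cast ?_ rfl).seq
          (((run_move _ (r := m + 3) (r' := m + 2) (tmp := m + 4) (by omega) (by omega) (by omega)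
            ?_).cast ?_ rfl).seq ((Run.push _ _ _).cast rfl ?_))))
        · funext r
          simp only [update_apply]
          split_ifs <;> first | omega | simp_all
        · simp
        · simp [load_of_le (rs := rs) (show rs.length ≤ m + 4 by omega)]
        · simp
        · funext r
          simp only [update_apply]
          split_ifs <;> simp_all [load_of_le, List.replicate_succ]
      refine ⟨_, ?_, Run.loop_cons ?_ h2 hr'⟩
      · have h3 : Tg (a, i, acc) ≤ (sz a + ((l a).length + B a) + 2) ^ c := by
          refine (hTg _).trans (Nat.pow_le_pow_left ?_ c)
          simp only
          omega
        have h4 : t ≤ (sz a + ((l a).length + B a) + 2) ^ c := ht.trans h3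
        have h5 : K a = (sz a + ((l a).length + B a) + 2) ^ c + 10 * B a + 6 := rfl
        rw [Nat.add_mul]
        omega
      · simp
  refine ⟨pl ;; pz.rename id ;; loop m body ;; clear (m + 1) ;; move (m + 2) m (m + 3),
    fun a => Tl a + (Tz a + (((l a).length * K a + 1) + ((2 * (l a).length + 1) +
      (8 * B a + 2)))),
    hTl.add (hTz.add (((hl'.mul hK).add (.const 1)).add ((((PolyBdd.const 2).mul hl').add
      (.const 1)).add (((PolyBdd.const 8).mul hB).add (.const 2))))), fun a => ?_⟩
  obtain ⟨t, ht, hr⟩ := hpl a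
  obtain ⟨u, hu, hr'⟩ := hpz a
  obtain ⟨v, hv, hs⟩ := step a (l a) 0 (by simp)
  have hbl := hb a _ le_rfl
  have e1 : load (rs ++ [l, fun _ => []]) a = update (load rs a) m (l a) := by
    rw [show rs ++ [l, fun _ => []] = rs ++ [l] ++ [fun _ => []] by simp, load_append_singleton,
      load_append_singleton, hm]
    rw [update_eq_self_iff, List.length_append, List.length_singleton, update_of_ne (by omega),
      load_of_le (by omega)]
  have h1 := hr'.rename_update (ρ := id) injective_id (S := update (load rs a) m (l a)) (by
    rw [e1]; rfl)
  have e2 : update (update (load rs a) m (l a)) (id (rs ++ [l, fun _ => []]).length) (z a)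
      = update (update (update (load rs a) m (l a)) (m + 1) (List.replicate 0 true)) (m + 2)
        (z a) := by
    funext r
    simp only [update_apply, id, List.length_append, List.length_cons, List.length_nil]
    split_ifs <;> simp_all [load_of_le]
  rw [e2] at h1
  refine ⟨_, ?_, hr.seq (h1.seq (hs.seq (((run_clear _ (m + 1)).cast
    (t' := 2 * (l a).length + 1) ?_ rfl).seq ((run_move _ (r := m + 2) (r' := m) (tmp := m + 3)
      (by omega) (by omega) (by omega) ?_).cast
      (t' := 8 * (Nat.rec (z a) (g a) (l a).length : List Bool).length + 2) ?_ ?_))))⟩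
  · beta_reduce
    omega
  · simp
  · simp [load_of_le (rs := rs) (show rs.length ≤ m + 3 by omega)]
  · simp
  · funext r
    by_cases h0 : r = m
    · subst h0
      simp [load_of_le hm.le]
    · by_cases h2 : r = m + 2
      · subst h2
        simp [load_of_le (rs := rs) (show rs.length ≤ m + 2 by omega)]
      · by_cases h3 : r = m + 1
        · subst h3
          simp [load_of_le (rs := rs) (show rs.length ≤ m + 1 by omega)]
        · simp [update_of_ne h0, update_of_ne h2, update_of_ne h3]

end FPL

open StackCmd Function

/-! ### The category of polynomial-time functions -/

/-- A type of data that a program keeps on a fixed number of stacks: `regs` lists the contents of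
the stacks, and `size` is the size with respect to which running times are measured. It may be
larger than the length of the data. -/
class Data (α : Type) where
  size : α → ℕ
  regs : List (α → List Bool)
  length_le : ∀ c ∈ regs, ∀ a, (c a).length ≤ size a

namespace Data

/-- A string is kept on one stack. -/
instance : Data (List Bool) := ⟨List.length, [fun l => l], by simp⟩

/-- A natural number is kept on one stack, in unary. -/
instance : Data ℕ := ⟨fun n => n, [fun n => List.replicate n true], by simp⟩

/-- A truth value is kept on one stack, as a string of length `1`. -/
instance : Data Bool := ⟨fun _ => 1, [fun b => [b]], by simp⟩

instance {α β : Type} [Data α] [Data β] : Data (α × β) where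
  size a := size a.1 + size a.2
  regs := regs.map (fun c => c ∘ Prod.fst) ++ regs.map (fun c => c ∘ Prod.snd)
  length_le c hc a := by
    simp only [List.mem_append, List.mem_map] at hc
    rcases hc with ⟨c, hc, rfl⟩ | ⟨c, hc, rfl⟩
    · exact (length_le c hc a.1).trans (Nat.le_add_right _ _)
    · exact (length_le c hc a.2).trans (Nat.le_add_left _ _)

end Data

/-- Polynomial-time functions: each stack of the result is computed in time polynomial in the size
of the argument, and so is the size of the result bounded. -/
@[fun_prop]
def FP {α β : Type} [Data α] [Data β] (f : α → β) : Prop :=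
  PolyBdd Data.size (fun a => Data.size (f a)) ∧
    ∀ c ∈ Data.regs (α := β), FPL Data.size Data.regs (c ∘ f)

namespace FP

variable {α β γ : Type} [Data α] [Data β] [Data γ]

theorem polyBdd {f : α → β} (hf : FP f) : PolyBdd Data.size fun a => Data.size (f a) := hf.1

theorem of_list {f : α → List Bool} (hf : FPL Data.size Data.regs f) : FP f :=
  ⟨hf.polyBdd, fun c hc => by rw [List.mem_singleton.1 hc]; exact hf⟩

theorem to_list {f : α → List Bool} (hf : FP f) : FPL Data.size Data.regs f :=
  hf.2 _ (List.mem_singleton_self _)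

theorem of_nat {f : α → ℕ} (hf : FPL Data.size Data.regs fun a => List.replicate (f a) true) :
    FP f :=
  ⟨hf.polyBdd.mono fun a => by simp [Data.size],
    fun c hc => by rw [List.mem_singleton.1 hc]; exact hf⟩

theorem to_nat {f : α → ℕ} (hf : FP f) :
    FPL Data.size Data.regs fun a => List.replicate (f a) true :=
  hf.2 _ (List.mem_singleton_self _)

theorem of_bool {f : α → Bool} (hf : FPL Data.size Data.regs fun a => [f a]) : FP f :=
  ⟨.const 1, fun c hc => by rw [List.mem_singleton.1 hc]; exact hf⟩

theorem to_bool {f : α → Bool} (hf : FP f) : FPL Data.size Data.regs fun a => [f a] :=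
  hf.2 _ (List.mem_singleton_self _)

theorem of_eq {f g : α → β} (hf : FP f) (h : ∀ a, f a = g a) : FP g :=
  (funext h : f = g) ▸ hf

@[fun_prop]
theorem id : FP fun a : α => a :=
  ⟨.self, fun c hc => .var hc (PolyBdd.self.mono (Data.length_le c hc))⟩

@[fun_prop]
theorem comp {g : β → γ} {f : α → β} (hg : FP g) (hf : FP f) : FP fun a => g (f a) := by
  refine ⟨hg.1.comp hf.1, fun c hc => ((hg.2 c hc).comp hf.1).subst fun d hd => ?_⟩
  obtain ⟨e, he, rfl⟩ := List.mem_map.1 hd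
  exact hf.2 e he

@[fun_prop]
theorem fst {f : α → β × γ} (hf : FP f) : FP fun a => (f a).1 := by
  refine ⟨hf.1.mono fun a => Nat.le_add_right _ _, fun c hc => hf.2 (c ∘ Prod.fst) ?_⟩
  exact List.mem_append_left _ (List.mem_map_of_mem hc)

@[fun_prop]
theorem snd {f : α → β × γ} (hf : FP f) : FP fun a => (f a).2 := by
  refine ⟨hf.1.mono fun a => Nat.le_add_left _ _, fun c hc => hf.2 (c ∘ Prod.snd) ?_⟩
  exact List.mem_append_right _ (List.mem_map_of_mem hc)

@[fun_prop]
theorem prodMk {f : α → β} {g : α → γ} (hf : FP f) (hg : FP g) : FP fun a => (f a, g a) := by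
  refine ⟨hf.1.add hg.1, fun c hc => ?_⟩
  simp only [Data.regs, List.mem_append, List.mem_map] at hc
  rcases hc with ⟨c, hc, rfl⟩ | ⟨c, hc, rfl⟩
  · exact hf.2 c hc
  · exact hg.2 c hc

theorem const_list (l : List Bool) : FP fun _ : α => l := by
  refine of_list ?_
  induction l with
  | nil => exact .nil
  | cons b l ih => exact ih.cons b

@[fun_prop]
theorem const_nil : FP fun _ : α => ([] : List Bool) := const_list []

@[fun_prop]
theorem const_nat (n : ℕ) : FP fun _ : α => n := of_nat (const_list _).to_list

@[fun_prop]
theorem const_bool (b : Bool) : FP fun _ : α => b := of_bool (const_list _).to_list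

@[fun_prop]
theorem append {f g : α → List Bool} (hf : FP f) (hg : FP g) : FP fun a => f a ++ g a :=
  of_list (hf.to_list.append hg.to_list)

@[fun_prop]
theorem tail {f : α → List Bool} (hf : FP f) : FP fun a => (f a).tail := of_list hf.to_list.tail

@[fun_prop]
theorem headD {f : α → List Bool} (hf : FP f) : FP fun a => (f a).headD false :=
  of_bool hf.to_list.head

@[fun_prop]
theorem singleton {f : α → Bool} (hf : FP f) : FP fun a => [f a] := of_list hf.to_bool

@[fun_prop]
theorem add {f g : α → ℕ} (hf : FP f) (hg : FP g) : FP fun a => f a + g a :=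
  of_nat ((hf.to_nat.append hg.to_nat).of_eq fun a => by simp)

@[fun_prop]
theorem pred {f : α → ℕ} (hf : FP f) : FP fun a => f a - 1 :=
  of_nat (hf.to_nat.tail.of_eq fun a => by simp)

@[fun_prop]
theorem pos {f : α → ℕ} (hf : FP f) : FP fun a => decide (0 < f a) :=
  of_bool (hf.to_nat.head.of_eq fun a => by cases f a <;> simp [List.replicate_succ])

@[fun_prop]
theorem ite_nat {c : α → Bool} {f g : α → ℕ} (hc : FP c) (hf : FP f) (hg : FP g) :
    FP fun a => if c a then f a else g a :=
  of_nat ((hc.to_bool.ite hf.to_nat hg.to_nat).of_eq fun a => by split_ifs <;> rfl)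

@[fun_prop]
theorem and {f g : α → Bool} (hf : FP f) (hg : FP g) : FP fun a => f a && g a :=
  of_bool ((hf.to_bool.ite hg.to_bool (const_bool false).to_bool).of_eq fun a => by
    cases f a <;> rfl)

@[fun_prop]
theorem or {f g : α → Bool} (hf : FP f) (hg : FP g) : FP fun a => f a || g a :=
  of_bool ((hf.to_bool.ite (const_bool true).to_bool hg.to_bool).of_eq fun a => by
    cases f a <;> rfl)

@[fun_prop]
theorem not {f : α → Bool} (hf : FP f) : FP fun a => !f a :=
  of_bool ((hf.to_bool.ite (const_bool false).to_bool (const_bool true).to_bool).of_eq fun a => by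
    cases f a <;> rfl)

/-- Bounded recursion over the length of a string. -/
theorem list_rec_length {l z : α → List Bool} {g : α → ℕ → List Bool → List Bool} (hl : FP l)
    (hz : FP z) (hg : FP fun q : α × ℕ × List Bool => g q.1 q.2.1 q.2.2) {B : α → ℕ}
    (hB : PolyBdd Data.size B)
    (hb : ∀ a, ∀ i ≤ (l a).length, (Nat.rec (z a) (g a) i : List Bool).length ≤ B a) :
    FP fun a => (Nat.rec (z a) (g a) (l a).length : List Bool) := by
  refine of_list (FPL.natRec hl.to_list hz.to_list ?_ hB hb)
  rw [List.append_assoc]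
  exact hg.to_list

/-- Bounded recursion with values in strings. -/
theorem list_rec {n : α → ℕ} {z : α → List Bool} {g : α → ℕ → List Bool → List Bool} (hn : FP n)
    (hz : FP z) (hg : FP fun q : α × ℕ × List Bool => g q.1 q.2.1 q.2.2) {B : α → ℕ}
    (hB : PolyBdd Data.size B)
    (hb : ∀ a, ∀ i ≤ n a, (Nat.rec (z a) (g a) i : List Bool).length ≤ B a) :
    FP fun a => (Nat.rec (z a) (g a) (n a) : List Bool) :=
  (list_rec_length (of_list hn.to_nat) hz hg hB (by simpa using hb)).of_eq fun a => by simp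

@[fun_prop]
theorem length {f : α → List Bool} (hf : FP f) : FP fun a => (f a).length := by
  have key : ∀ n, (Nat.rec [] (fun _ l => [true] ++ l) n : List Bool) = List.replicate n true := by
    intro n
    induction n with
    | zero => rfl
    | succ n ih => exact congrArg (List.cons true) ih
  refine of_nat ((list_rec_length (g := fun _ _ l => [true] ++ l) hf const_nil ?_
    hf.polyBdd fun a i hi => ?_).to_list.of_eq fun a => key _)
  · exact (const_list _).append (snd (snd id))
  · rw [key, List.length_replicate]
    exact hi

/-- Bounded recursion with values in natural numbers. -/
theorem nat_rec {n : α → ℕ} {z : α → ℕ} {g : α → ℕ → ℕ → ℕ} (hn : FP n) (hz : FP z)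
    (hg : FP fun q : α × ℕ × ℕ => g q.1 q.2.1 q.2.2) {B : α → ℕ} (hB : PolyBdd Data.size B)
    (hb : ∀ a, ∀ i ≤ n a, (Nat.rec (z a) (g a) i : ℕ) ≤ B a) :
    FP fun a => (Nat.rec (z a) (g a) (n a) : ℕ) := by
  have key : ∀ a i, (Nat.rec (List.replicate (z a) true)
      (fun i l => List.replicate (g a i l.length) true) i : List Bool)
      = List.replicate (Nat.rec (z a) (g a) i) true := by
    intro a i
    induction i with
    | zero => rfl
    | succ i ih => simp only [ih, List.length_replicate]
  have h1 : FP fun q : α × ℕ × List Bool => g q.1 q.2.1 q.2.2.length :=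
    hg.comp (f := fun q : α × ℕ × List Bool => (q.1, q.2.1, q.2.2.length)) (by fun_prop)
  refine of_nat ((list_rec (z := fun a => List.replicate (z a) true)
    (g := fun a i l => List.replicate (g a i l.length) true) hn (of_list hz.to_nat)
    (of_list h1.to_nat) hB fun a i hi => ?_).to_list.of_eq fun a => key a _)
  rw [key, List.length_replicate]
  exact hb a i hi

@[fun_prop]
theorem mul {f g : α → ℕ} (hf : FP f) (hg : FP g) : FP fun a => f a * g a := by
  have key : ∀ a i, (Nat.rec 0 (fun _ m => m + f a) i : ℕ) = f a * i := by
    intro a i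
    induction i with
    | zero => rfl
    | succ i ih => simp only [ih, Nat.mul_succ]
  refine (nat_rec (g := fun a _ m => m + f a) hg (const_nat 0) (by fun_prop)
    (hf.polyBdd.mul hg.polyBdd) fun a i hi => ?_).of_eq fun a => key a _
  rw [key]
  exact Nat.mul_le_mul_left _ hi

@[fun_prop]
theorem sub {f g : α → ℕ} (hf : FP f) (hg : FP g) : FP fun a => f a - g a := by
  have key : ∀ a i, (Nat.rec (f a) (fun _ m => m - 1) i : ℕ) = f a - i := by
    intro a i
    induction i with
    | zero => rfl
    | succ i ih => simp only [ih, Nat.sub_sub]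
  refine (nat_rec (g := fun a _ m => m - 1) hg hf (by fun_prop) hf.polyBdd
    fun a i hi => ?_).of_eq fun a => key a _
  rw [key]
  exact Nat.sub_le _ _

@[fun_prop]
theorem lt {f g : α → ℕ} (hf : FP f) (hg : FP g) : FP fun a => decide (f a < g a) :=
  (hg.sub hf).pos.of_eq fun a => by simp

@[fun_prop]
theorem le {f g : α → ℕ} (hf : FP f) (hg : FP g) : FP fun a => decide (f a ≤ g a) :=
  (hg.lt hf).not.of_eq fun a => by
    rw [← decide_not, decide_eq_decide, not_lt]

@[fun_prop]
theorem eq {f g : α → ℕ} (hf : FP f) (hg : FP g) : FP fun a => decide (f a = g a) :=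
  ((hf.le hg).and (hg.le hf)).of_eq fun a => by simp [le_antisymm_iff]

@[fun_prop]
theorem drop {f : α → ℕ} {l : α → List Bool} (hf : FP f) (hl : FP l) :
    FP fun a => (l a).drop (f a) := by
  have key : ∀ a i, (Nat.rec (l a) (fun _ m => m.tail) i : List Bool) = (l a).drop i := by
    intro a i
    induction i with
    | zero => simp
    | succ i ih => simp only [ih, List.tail_drop]
  refine (list_rec (g := fun a _ m => m.tail) hf hl (by fun_prop) hl.polyBdd
    fun a i hi => ?_).of_eq fun a => key a _
  rw [key, List.length_drop]
  exact Nat.sub_le _ _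

@[fun_prop]
theorem getD {l : α → List Bool} {f : α → ℕ} (hl : FP l) (hf : FP f) :
    FP fun a => (l a).getD (f a) false :=
  (hf.drop hl).headD.of_eq fun a => by
    simp [List.headD_eq_head?_getD]

end FP

/-! ### Bounded quantifiers and tables -/

/-- The number of `i < n` with `P i`. -/
def cnt (n : ℕ) (P : ℕ → Bool) : ℕ := Nat.rec 0 (fun i m => if P i then m + 1 else m) n

theorem cnt_eq (n : ℕ) (P : ℕ → Bool) : cnt n P = ((Finset.range n).filter fun i => P i).card := by
  induction n with
  | zero => rfl
  | succ n ih =>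
    change (if P n then cnt n P + 1 else cnt n P) = _
    rw [ih, Finset.range_add_one, Finset.filter_insert]
    split_ifs <;> simp

/-- Is there `i < n` with `P i`? -/
def bex (n : ℕ) (P : ℕ → Bool) : Bool := decide (0 < cnt n P)

/-- Is `P i` true for all `i < n`? -/
def ball (n : ℕ) (P : ℕ → Bool) : Bool := !bex n fun i => !P i

@[simp]
theorem bex_iff {n : ℕ} {P : ℕ → Bool} : bex n P = true ↔ ∃ i < n, P i = true := by
  simp [bex, cnt_eq, Finset.card_pos, Finset.Nonempty]

@[simp]
theorem ball_iff {n : ℕ} {P : ℕ → Bool} : ball n P = true ↔ ∀ i < n, P i = true := by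
  rw [ball, Bool.not_eq_true', Bool.eq_false_iff, ne_eq, bex_iff]
  simp

/-- The table of `P i` for `i < n`. -/
def tab (n : ℕ) (P : ℕ → Bool) : List Bool := (List.range n).map P

theorem getD_tab {n : ℕ} {P : ℕ → Bool} {i : ℕ} (h : i < n) : (tab n P).getD i false = P i := by
  simp [tab, h]

@[simp]
theorem length_tab (n : ℕ) (P : ℕ → Bool) : (tab n P).length = n := by simp [tab]

namespace FP

variable {α : Type} [Data α] {n : α → ℕ} {P : α → ℕ → Bool}

@[fun_prop]
theorem cnt (hn : FP n) (hP : FP fun q : α × ℕ => P q.1 q.2) : FP fun a => cnt (n a) (P a) := by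
  have h1 : FP fun q : α × ℕ × ℕ => P q.1 q.2.1 :=
    hP.comp (f := fun q : α × ℕ × ℕ => (q.1, q.2.1)) (by fun_prop)
  refine nat_rec (z := fun _ => 0) (g := fun a i m => if P a i then m + 1 else m) hn (const_nat 0)
    (h1.ite_nat (by fun_prop) (by fun_prop)) hn.polyBdd fun a i hi => ?_
  refine le_trans ?_ hi
  refine (cnt_eq i (P a)).trans_le ((Finset.card_filter_le _ _).trans_eq (Finset.card_range i))

@[fun_prop]
theorem bex (hn : FP n) (hP : FP fun q : α × ℕ => P q.1 q.2) : FP fun a => bex (n a) (P a) :=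
  (hn.cnt hP).pos

@[fun_prop]
theorem ball (hn : FP n) (hP : FP fun q : α × ℕ => P q.1 q.2) : FP fun a => ball (n a) (P a) :=
  (hn.bex (P := fun a i => !P a i) hP.not).not

@[fun_prop]
theorem tab (hn : FP n) (hP : FP fun q : α × ℕ => P q.1 q.2) : FP fun a => tab (n a) (P a) := by
  have h1 : FP fun q : α × ℕ × List Bool => P q.1 q.2.1 :=
    hP.comp (f := fun q : α × ℕ × List Bool => (q.1, q.2.1)) (by fun_prop)
  have key : ∀ a i, (Nat.rec [] (fun i l => l ++ [P a i]) i : List Bool) = _root_.tab i (P a) := by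
    intro a i
    induction i with
    | zero => rfl
    | succ i ih => simp only [ih, _root_.tab, List.range_succ, List.map_append, List.map_cons,
        List.map_nil]
  refine (list_rec (z := fun _ => []) (g := fun a i l => l ++ [P a i]) hn const_nil
    (append (by fun_prop) h1.singleton) hn.polyBdd fun a i hi => ?_).of_eq fun a => key a _
  rw [key, length_tab]
  exact hi

theorem half {f : α → ℕ} (hf : FP f) : FP fun a => f a / 2 := by
  refine (hf.cnt (P := fun a i => decide (i + i + 2 ≤ f a)) ?_).of_eq fun a => ?_
  · have : FP fun q : α × ℕ => f q.1 := hf.comp (by fun_prop)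
    fun_prop
  · rw [cnt_eq, ← Finset.card_range (f a / 2)]
    congr 1
    ext i
    simp only [Finset.mem_filter, Finset.mem_range, decide_eq_true_eq]
    omega

@[fun_prop]
theorem testBit {f g : α → ℕ} (hf : FP f) (hg : FP g) : FP fun a => (f a).testBit (g a) := by
  have key : ∀ a i, (Nat.rec (f a) (fun _ m => m / 2) i : ℕ) = f a / 2 ^ i := by
    intro a i
    induction i with
    | zero => simp
    | succ i ih => simp only [ih, pow_succ, Nat.div_div_eq_div_mul]
  have h1 : FP fun a => f a / 2 ^ g a := by
    refine (nat_rec (g := fun _ _ m => m / 2) hg hf (half (snd (snd id))) hf.polyBdd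
      fun a i _ => ?_).of_eq fun a => key a _
    rw [key]
    exact Nat.div_le_self _ _
  refine ((h1.sub (h1.half.add h1.half)).pos).of_eq fun a => ?_
  rw [Nat.testBit_eq_decide_div_mod_eq]
  congr 1
  simp only [eq_iff_iff]
  omega

end FP

/-! ### Connected vertex sets with a large neighborhood -/

namespace SimpleGraph

variable {V : Type*} [Fintype V] [DecidableEq V] (G : SimpleGraph V)

open Classical in
/-- The (open) neighborhood of a set `C` of vertices: the vertices outside of `C` that have a
neighbor in `C`. -/
noncomputable def nbhd (C : Finset V) : Finset V :=
  Finset.univ.filter fun v => v ∉ C ∧ ∃ u ∈ C, G.Adj u v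

open Classical in
/-- The closed neighborhood of a vertex. -/
noncomputable def closedNbhd (v : V) : Finset V :=
  Finset.univ.filter fun w => w = v ∨ G.Adj v w

/-- The set `C` of vertices is connected: it is not empty, and an edge leaves every nonempty proper
subset of it inside of `C`. -/
def ConnSet (C : Finset V) : Prop :=
  C.Nonempty ∧ ∀ A ⊆ C, A.Nonempty → A ≠ C → ∃ u ∈ A, ∃ v ∈ C, v ∉ A ∧ G.Adj u v

variable {G} {C : Finset V} {u v : V}

@[simp]
theorem mem_nbhd : v ∈ G.nbhd C ↔ v ∉ C ∧ ∃ u ∈ C, G.Adj u v := by simp [nbhd]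

@[simp]
theorem mem_closedNbhd : v ∈ G.closedNbhd u ↔ v = u ∨ G.Adj u v := by simp [closedNbhd]

theorem closedNbhd_eq : G.closedNbhd v = insert v (G.nbhd {v}) := by
  ext w
  by_cases h : w = v <;> simp [h]

theorem card_closedNbhd : (G.closedNbhd v).card = (G.nbhd {v}).card + 1 := by
  rw [closedNbhd_eq, Finset.card_insert_of_notMem (by simp)]

theorem ConnSet.singleton (v : V) : G.ConnSet {v} :=
  ⟨by simp, fun A hA hA' hne => absurd (hA'.subset_singleton_iff.1 hA) hne⟩

theorem ConnSet.insert_of_mem_nbhd (hC : G.ConnSet C) (hv : v ∈ G.nbhd C) :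
    G.ConnSet (insert v C) := by
  obtain ⟨hvC, u, hu, huv⟩ := mem_nbhd.1 hv
  refine ⟨Finset.insert_nonempty _ _, fun A hA hA' hne => ?_⟩
  have hA1 : A.erase v ⊆ C := by rwa [← Finset.subset_insert_iff]
  by_cases hvA : v ∈ A
  · by_cases he : (A.erase v).Nonempty
    · have : A.erase v ≠ C := fun h => hne (by rw [← h, Finset.insert_erase hvA])
      obtain ⟨x, hx, y, hy, hyA, hxy⟩ := hC.2 _ hA1 he this
      refine ⟨x, Finset.mem_of_mem_erase hx, y, Finset.mem_insert_of_mem hy, fun h => hyA ?_, hxy⟩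
      exact Finset.mem_erase.2 ⟨fun h => hvC (h ▸ hy), h⟩
    · refine ⟨v, hvA, u, Finset.mem_insert_of_mem hu, fun h => he ⟨u, ?_⟩, huv.symm⟩
      exact Finset.mem_erase.2 ⟨fun h => hvC (h ▸ hu), h⟩
  · rw [Finset.erase_eq_of_notMem hvA] at hA1
    by_cases hAC : A = C
    · exact ⟨u, hAC ▸ hu, v, Finset.mem_insert_self _ _, hvA, huv⟩
    · obtain ⟨x, hx, y, hy, hyA, hxy⟩ := hC.2 _ hA1 hA' hAC
      exact ⟨x, hx, y, Finset.mem_insert_of_mem hy, hyA, hxy⟩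

/-- A vertex with a single neighbor in a connected set may be removed from the set. -/
theorem ConnSet.erase_of_pendant (hC : G.ConnSet C) {a b : V} (ha : a ∈ C) (hb : b ∈ C)
    (hab : G.Adj a b) (h : ∀ x ∈ C, G.Adj a x → x = b) : G.ConnSet (C.erase a) := by
  refine ⟨⟨b, Finset.mem_erase.2 ⟨hab.ne', hb⟩⟩, fun A hA hA' hne => ?_⟩
  have haA : a ∉ A := fun h => Finset.notMem_erase a C (hA h)
  have hAC : A ⊆ C := hA.trans (Finset.erase_subset _ _)
  by_cases hbA : b ∈ A
  · obtain ⟨x, hx, y, hy, hyA, hxy⟩ := hC.2 (insert a A) (Finset.insert_subset ha hAC)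
      (Finset.insert_nonempty _ _) (fun h => hne (by rw [← h, Finset.erase_insert haA]))
    have hya : y ≠ a := fun h => hyA (h ▸ Finset.mem_insert_self _ _)
    have hyA' : y ∉ A := fun h => hyA (Finset.mem_insert_of_mem h)
    rcases Finset.mem_insert.1 hx with rfl | hx
    · exact absurd (h y hy hxy ▸ hbA) hyA'
    · exact ⟨x, hx, y, Finset.mem_erase.2 ⟨hya, hy⟩, hyA', hxy⟩
  · obtain ⟨x, hx, y, hy, hyA, hxy⟩ := hC.2 A hAC hA' (fun h => haA (h ▸ ha))
    refine ⟨x, hx, y, Finset.mem_erase.2 ⟨?_, hy⟩, hyA, hxy⟩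
    rintro rfl
    exact hbA (h x (hAC hx) hxy.symm ▸ hx)

theorem Connected.connSet_univ (hG : G.Connected) : G.ConnSet Finset.univ := by
  obtain ⟨r⟩ := hG.nonempty
  refine ⟨⟨r, Finset.mem_univ r⟩, fun A _ ⟨a, ha⟩ hne => ?_⟩
  by_contra! h
  refine hne (Finset.eq_univ_of_forall fun v => ?_)
  have := (reachable_iff_reflTransGen a v).1 (hG.preconnected a v)
  induction this with
  | refl => exact ha
  | tail _ hxy ih =>
    by_contra hy
    exact h _ ih _ (Finset.mem_univ _) hy hxy

/-! ### The vertices cut out by a set of leaves -/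

variable (G) in
open Classical in
/-- The vertices that can be reached from `r` by a walk that enters no vertex of `L`. -/
noncomputable def reachSet (L : Finset V) (r : V) : Finset V :=
  Finset.univ.filter fun v => Relation.ReflTransGen (fun u v => G.Adj u v ∧ v ∉ L) r v

theorem connSet_reachSet (L : Finset V) (r : V) : G.ConnSet (G.reachSet L r) := by
  have hr : r ∈ G.reachSet L r := by simp [reachSet, Relation.ReflTransGen.refl]
  have tail : ∀ u v, u ∈ G.reachSet L r → G.Adj u v → v ∉ L → v ∈ G.reachSet L r := by
    intro u v hu huv hv
    simp only [reachSet, Finset.mem_filter, Finset.mem_univ, true_and] at hu ⊢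
    exact hu.tail ⟨huv, hv⟩
  refine ⟨⟨r, hr⟩, fun A hA hA' hne => ?_⟩
  by_contra! h
  by_cases hrA : r ∈ A
  · refine hne (hA.antisymm fun v hv => ?_)
    have hv' := hv
    simp only [reachSet, Finset.mem_filter, Finset.mem_univ, true_and] at hv
    induction hv with
    | refl => exact hrA
    | @tail x y hrx hxy ih =>
      by_contra hyA
      exact h x (ih (by simpa [reachSet] using hrx)) y hv' hyA hxy.1
  · obtain ⟨a, ha⟩ := hA'
    have key : ∀ v, Relation.ReflTransGen (fun u v => G.Adj u v ∧ v ∉ L) r v → v ∉ A := by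
      intro v hv
      induction hv with
      | refl => exact hrA
      | @tail x y hrx hxy ih =>
        intro hy
        exact h y hy x (by simpa [reachSet] using hrx) ih hxy.1.symm
    exact key a (by simpa [reachSet] using hA ha) ha

theorem ConnSet.reachSet_nbhd (hC : G.ConnSet C) {r : V} (hr : r ∈ C) :
    G.reachSet (G.nbhd C) r = C := by
  have hsub : G.reachSet (G.nbhd C) r ⊆ C := by
    intro v hv
    simp only [reachSet, Finset.mem_filter, Finset.mem_univ, true_and] at hv
    induction hv with
    | refl => exact hr
    | @tail x y _ hxy ih =>
      by_contra hy
      exact hxy.2 (mem_nbhd.2 ⟨hy, x, ih, hxy.1⟩)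
  by_contra hne
  obtain ⟨x, hx, y, hy, hy', hxy⟩ := hC.2 _ hsub (connSet_reachSet _ r).1 hne
  apply hy'
  simp only [reachSet, Finset.mem_filter, Finset.mem_univ, true_and] at hx ⊢
  exact hx.tail ⟨hxy, fun h => (mem_nbhd.1 h).1 hy⟩

/-! ### Candidates for leaves -/

variable (G) in
open Classical in
/-- The candidates for leaves: the neighbors of the vertices whose degree is at least `3` or at
least `k`. -/
noncomputable def candidates (k : ℕ) : Finset V :=
  Finset.univ.filter fun v => ∃ u, G.Adj u v ∧ (3 ≤ (G.nbhd {u}).card ∨ k ≤ (G.nbhd {u}).card)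

/-- The neighborhood of a smallest connected set with at least `k` neighbors consists of
candidates: a vertex `a` of the set that has degree at most `2` and is adjacent to a neighbor `v`
of the set could be removed from the set, becoming itself a neighbor instead of `v`. -/
theorem exists_connSet_nbhd_subset_candidates {k : ℕ} (hC : G.ConnSet C)
    (hk : k ≤ (G.nbhd C).card) :
    ∃ C, G.ConnSet C ∧ k ≤ (G.nbhd C).card ∧ G.nbhd C ⊆ G.candidates k := by
  induction hn : C.card using Nat.strong_induction_on generalizing C with
  | _ n ih =>
    subst hn
    by_cases hsub : G.nbhd C ⊆ G.candidates k
    · exact ⟨C, hC, hk, hsub⟩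
    obtain ⟨v, hv, hvc⟩ := Finset.not_subset.1 hsub
    obtain ⟨hvC, a, ha, hav⟩ := mem_nbhd.1 hv
    have hdeg : (G.nbhd {a}).card < 3 ∧ (G.nbhd {a}).card < k := by
      simp only [candidates, Finset.mem_filter, Finset.mem_univ, true_and, not_exists, not_and,
        not_or, not_le] at hvc
      exact hvc a hav
    have hCa : ({a} : Finset V) ≠ C := by
      rintro rfl
      omega
    obtain ⟨a', ha', b, hb, hba, hab⟩ := hC.2 {a} (by simpa using ha) (by simp) hCa
    obtain rfl := Finset.mem_singleton.1 ha'
    have hvb : v ≠ b := fun h => hvC (h ▸ hb)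
    have hN : {v, b} = G.nbhd {a'} := by
      refine Finset.eq_of_subset_of_card_le ?_ ?_
      · intro w hw
        simp only [Finset.mem_insert, Finset.mem_singleton] at hw
        rcases hw with rfl | rfl
        · simp [hav, hav.ne']
        · simp [hab, hab.ne']
      · rw [Finset.card_pair hvb]
        omega
    have hN' : ∀ w, G.Adj a' w → w = v ∨ w = b := by
      intro w hw
      have : w ∈ G.nbhd {a'} := by simp [hw, hw.ne']
      rw [← hN] at this
      simpa using this
    have hC' := hC.erase_of_pendant ha hb hab fun x hx hax => (hN' x hax).resolve_left
      fun h => hvC (h ▸ hx)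
    refine ih _ (Finset.card_erase_lt_of_mem ha) hC' (hk.trans ?_) rfl
    have hcard : (insert a' ((G.nbhd C).erase v)).card = (G.nbhd C).card := by
      rw [Finset.card_insert_of_notMem (by simp [ha]), Finset.card_erase_of_mem hv]
      have := Finset.card_pos.2 ⟨v, hv⟩
      omega
    rw [← hcard]
    refine Finset.card_le_card fun w hw => ?_
    rcases Finset.mem_insert.1 hw with rfl | hw
    · exact mem_nbhd.2 ⟨Finset.notMem_erase _ _, b, Finset.mem_erase.2 ⟨hab.ne', hb⟩, hab.symm⟩
    · obtain ⟨hwv, hw⟩ := Finset.mem_erase.1 hw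
      obtain ⟨hwC, x, hx, hxw⟩ := mem_nbhd.1 hw
      refine mem_nbhd.2 ⟨fun h => hwC (Finset.mem_of_mem_erase h), x, Finset.mem_erase.2 ⟨?_, hx⟩,
        hxw⟩
      rintro rfl
      rcases hN' w hxw with rfl | rfl
      · exact hwv rfl
      · exact hwC hb

/-! ### Graphs with many candidates -/

/-- Let a connected set `J` avoid the closed neighborhoods of the vertices of `S` outside of `P`,
but let a neighbor `y` of `J` be adjacent to such a vertex `s`. Adding `y` and `s` to `J` turns the
at least two other neighbors of `s` into neighbors of the set. -/
theorem ConnSet.absorb {S P J : Finset V} (hJ : G.ConnSet J)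
    (hS : ∀ s ∈ S, ∀ s' ∈ S, s ≠ s' → Disjoint (G.closedNbhd s) (G.closedNbhd s'))
    (hd : ∀ s ∈ S, 3 ≤ (G.nbhd {s}).card)
    (hP : ∀ s ∈ S \ P, Disjoint (G.closedNbhd s) J) {s y : V} (hs : s ∈ S \ P)
    (hy : y ∈ G.nbhd J) (hys : y ∈ G.closedNbhd s) :
    ∃ I, J.card < I.card ∧ G.ConnSet I ∧
      (∀ s' ∈ S \ insert s P, Disjoint (G.closedNbhd s') I) ∧
      (G.nbhd J \ (S \ P).biUnion G.closedNbhd).card + 2 ≤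
        (G.nbhd I \ (S \ insert s P).biUnion G.closedNbhd).card := by
  have hs' := Finset.mem_sdiff.1 hs
  have hsJ : s ∉ J := fun h => Finset.disjoint_left.1 (hP s hs) (by simp) h
  have hsy : y ≠ s := by
    rintro rfl
    obtain ⟨_, x, hx, hxy⟩ := mem_nbhd.1 hy
    exact Finset.disjoint_left.1 (hP y hs) (mem_closedNbhd.2 (.inr hxy.symm)) hx
  have hadj : G.Adj s y := (mem_closedNbhd.1 hys).resolve_left hsy
  have h1 : s ∈ G.nbhd (insert y J) := by
    simp only [mem_nbhd, Finset.mem_insert, not_or]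
    exact ⟨⟨hsy.symm, hsJ⟩, y, .inl rfl, hadj.symm⟩
  have hmem : ∀ s' ∈ S \ insert s P, s' ∈ S \ P ∧ Disjoint (G.closedNbhd s) (G.closedNbhd s') := by
    intro s' h
    simp only [Finset.mem_sdiff, Finset.mem_insert, not_or] at h
    exact ⟨Finset.mem_sdiff.2 ⟨h.1, h.2.2⟩, hS s hs'.1 s' h.1 (Ne.symm h.2.1)⟩
  refine ⟨insert s (insert y J), ?_, (hJ.insert_of_mem_nbhd hy).insert_of_mem_nbhd h1,
    fun s' h => ?_, ?_⟩
  · rw [Finset.card_insert_of_notMem (mem_nbhd.1 h1).1,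
      Finset.card_insert_of_notMem (mem_nbhd.1 hy).1]
    omega
  · obtain ⟨h2, h3⟩ := hmem s' h
    rw [Finset.disjoint_insert_right, Finset.disjoint_insert_right]
    exact ⟨Finset.disjoint_left.1 h3 (by simp), Finset.disjoint_left.1 h3 hys, hP s' h2⟩
  · set W := (S \ P).biUnion G.closedNbhd
    have hdis : Disjoint (G.nbhd J \ W) ((G.nbhd {s}).erase y) := by
      rw [Finset.disjoint_left]
      intro w hw hw'
      simp only [Finset.mem_erase, mem_nbhd, Finset.mem_singleton, exists_eq_left] at hw'
      exact (Finset.mem_sdiff.1 hw).2 (Finset.mem_biUnion.2 ⟨s, hs, by simp [hw'.2.2]⟩)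
    have hc : 2 ≤ ((G.nbhd {s}).erase y).card := by
      rw [Finset.card_erase_of_mem (by simp [hsy, hadj])]
      have := hd s hs'.1
      omega
    calc (G.nbhd J \ W).card + 2 ≤ (G.nbhd J \ W ∪ (G.nbhd {s}).erase y).card := by
          rw [Finset.card_union_of_disjoint hdis]; omega
      _ ≤ _ := Finset.card_le_card fun w hw => ?_
    rcases Finset.mem_union.1 hw with hw | hw
    · obtain ⟨hw, hwW⟩ := Finset.mem_sdiff.1 hw
      obtain ⟨hwJ, x, hx, hxw⟩ := mem_nbhd.1 hw
      refine Finset.mem_sdiff.2 ⟨mem_nbhd.2 ⟨?_, x, by simp [hx], hxw⟩, fun h => hwW ?_⟩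
      · simp only [Finset.mem_insert, not_or]
        refine ⟨?_, ?_, hwJ⟩
        · rintro rfl
          exact hwW (Finset.mem_biUnion.2 ⟨w, hs, by simp⟩)
        · rintro rfl
          exact hwW (Finset.mem_biUnion.2 ⟨s, hs, hys⟩)
      · obtain ⟨s', h1, h2⟩ := Finset.mem_biUnion.1 h
        exact Finset.mem_biUnion.2 ⟨s', (hmem s' h1).1, h2⟩
    · simp only [Finset.mem_erase, mem_nbhd, Finset.mem_singleton, exists_eq_left] at hw
      have hws : w ∈ G.closedNbhd s := by simp [hw.2.2]
      refine Finset.mem_sdiff.2 ⟨mem_nbhd.2 ⟨?_, s, by simp, hw.2.2⟩, fun h => ?_⟩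
      · simp only [Finset.mem_insert, not_or]
        exact ⟨hw.2.1, hw.1, Finset.disjoint_left.1 (hP s hs) hws⟩
      · obtain ⟨s', h1, h2⟩ := Finset.mem_biUnion.1 h
        exact Finset.disjoint_left.1 (hmem s' h1).2 hws h2

/-- A connected graph with vertices of degree at least `3` whose closed neighborhoods are disjoint
has a connected set with at least as many neighbors. The set `I` grows, `P` being the vertices of
`S` that it has absorbed already; the neighbors of `I` close to other vertices of `S` are not
counted. -/
theorem exists_connSet_of_disjoint (hG : G.ConnSet Finset.univ) {S : Finset V}
    (hS : ∀ s ∈ S, ∀ s' ∈ S, s ≠ s' → Disjoint (G.closedNbhd s) (G.closedNbhd s'))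
    (hd : ∀ s ∈ S, 3 ≤ (G.nbhd {s}).card) :
    ∃ C, G.ConnSet C ∧ S.card ≤ (G.nbhd C).card := by
  have main : ∀ (m : ℕ) (I P : Finset V), Fintype.card V - I.card = m → G.ConnSet I → P ⊆ S →
      (∀ s ∈ S \ P, Disjoint (G.closedNbhd s) I) →
      P.card ≤ (G.nbhd I \ (S \ P).biUnion G.closedNbhd).card →
      ∃ C, G.ConnSet C ∧ S.card ≤ (G.nbhd C).card := by
    intro m
    induction m using Nat.strong_induction_on with
    | _ m ih =>
      rintro I P rfl hI hPS hP hcard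
      have hlt : ∀ J : Finset V, I.card < J.card →
          Fintype.card V - J.card < Fintype.card V - I.card := by
        intro J hJ
        have := J.card_le_univ
        omega
      by_cases hPS' : S \ P = ∅
      · refine ⟨I, hI, ?_⟩
        rw [(Finset.sdiff_eq_empty_iff_subset.1 hPS').antisymm hPS]
        exact hcard.trans (Finset.card_le_card Finset.sdiff_subset)
      have absorbed : ∀ s ∈ S \ P, insert s P ⊆ S ∧ (insert s P).card = P.card + 1 := by
        intro s hs
        obtain ⟨h1, h2⟩ := Finset.mem_sdiff.1 hs
        exact ⟨Finset.insert_subset h1 hPS, Finset.card_insert_of_notMem h2⟩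
      set W := (S \ P).biUnion G.closedNbhd with hW
      by_cases hIW : Disjoint (G.nbhd I) W
      · obtain ⟨s, hs⟩ := Finset.nonempty_iff_ne_empty.2 hPS'
        have hsW : s ∈ W := Finset.mem_biUnion.2 ⟨s, hs, by simp⟩
        -- `I` together with its neighborhood misses `s`, so some edge `u y` leaves it.
        obtain ⟨u, hu, y, -, hy, huy⟩ := hG.2 (I ∪ G.nbhd I) (Finset.subset_univ _)
          (hI.1.mono Finset.subset_union_left) (by
            intro h
            rcases Finset.mem_union.1 (h ▸ Finset.mem_univ s) with h | h
            · exact Finset.disjoint_left.1 (hP s hs) (by simp) h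
            · exact Finset.disjoint_left.1 hIW h hsW)
        simp only [Finset.mem_union, not_or] at hy
        have huI : u ∈ G.nbhd I := by
          refine (Finset.mem_union.1 hu).resolve_left fun h => hy.2 ?_
          exact mem_nbhd.2 ⟨hy.1, u, h, huy⟩
        have huW : u ∉ W := Finset.disjoint_left.1 hIW huI
        have hyu : y ≠ u := huy.ne'
        set J := insert u I with hJ
        have hJI : I.card < J.card := by
          rw [hJ, Finset.card_insert_of_notMem (mem_nbhd.1 huI).1]
          omega
        have hJc : G.ConnSet J := hI.insert_of_mem_nbhd huI
        have hyJ : y ∈ G.nbhd J := mem_nbhd.2 ⟨by simp [hJ, hyu, hy.1], u, by simp [hJ], huy⟩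
        have hJP : ∀ s ∈ S \ P, Disjoint (G.closedNbhd s) J := by
          intro s hs
          rw [hJ, Finset.disjoint_insert_right]
          exact ⟨fun h => huW (Finset.mem_biUnion.2 ⟨s, hs, h⟩), hP s hs⟩
        have hsub : (G.nbhd I \ W).erase u ⊆ G.nbhd J \ W := by
          intro w hw
          obtain ⟨hwu, hw⟩ := Finset.mem_erase.1 hw
          obtain ⟨hw, hwW⟩ := Finset.mem_sdiff.1 hw
          obtain ⟨hwI, x, hx, hxw⟩ := mem_nbhd.1 hw
          exact Finset.mem_sdiff.2
            ⟨mem_nbhd.2 ⟨by simp [hJ, hwu, hwI], x, by simp [hJ, hx], hxw⟩, hwW⟩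
        have hmem : u ∈ G.nbhd I \ W := Finset.mem_sdiff.2 ⟨huI, huW⟩
        have hce := Finset.card_erase_of_mem hmem
        have hpos := Finset.card_pos.2 ⟨u, hmem⟩
        by_cases hyW : y ∈ W
        · obtain ⟨s, hs, hys⟩ := Finset.mem_biUnion.1 hyW
          obtain ⟨I', h1, h2, h3, h4⟩ := hJc.absorb hS hd hJP hs hyJ hys
          refine ih _ (hlt I' (hJI.trans h1)) I' (insert s P) rfl h2 (absorbed s hs).1 h3 ?_
          have := Finset.card_le_card hsub
          have := (absorbed s hs).2
          rw [← hW] at h4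
          omega
        · refine ih _ (hlt J hJI) J P rfl hJc hPS hJP (hcard.trans ?_)
          rw [← hW]
          have hsub' : insert y ((G.nbhd I \ W).erase u) ⊆ G.nbhd J \ W :=
            Finset.insert_subset (Finset.mem_sdiff.2 ⟨hyJ, hyW⟩) hsub
          have := Finset.card_le_card hsub'
          rw [Finset.card_insert_of_notMem (fun h => hy.2
            (Finset.mem_sdiff.1 (Finset.mem_of_mem_erase h)).1)] at this
          omega
      · obtain ⟨y, hy, hyW⟩ := Finset.not_disjoint_iff.1 hIW
        obtain ⟨s, hs, hys⟩ := Finset.mem_biUnion.1 hyW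
        obtain ⟨I', h1, h2, h3, h4⟩ := hI.absorb hS hd hP hs hy hys
        refine ih _ (hlt I' h1) I' (insert s P) rfl h2 (absorbed s hs).1 h3 ?_
        have := (absorbed s hs).2
        rw [← hW] at h4
        omega
  rcases S.eq_empty_or_nonempty with rfl | ⟨s, hs⟩
  · obtain ⟨v, -⟩ := hG.1
    exact ⟨{v}, .singleton v, by simp⟩
  · have hdis : ∀ s' ∈ S \ {s}, Disjoint (G.closedNbhd s') (G.closedNbhd s) := by
      intro s' h
      obtain ⟨h1, h2⟩ := Finset.mem_sdiff.1 h
      exact hS s' h1 s hs (by simpa using h2)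
    refine main _ {s} {s} rfl (.singleton s) (by simpa using hs) (fun s' h => ?_) ?_
    · exact (hdis s' h).mono_right (by simp)
    · rw [Finset.sdiff_eq_self_of_disjoint, Finset.card_singleton]
      · have := hd s hs
        omega
      · rw [Finset.disjoint_biUnion_right]
        intro s' h
        refine (hdis s' h).symm.mono_left ?_
        rw [closedNbhd_eq]
        exact Finset.subset_insert _ _

/-- A connected graph with more than `k ^ 4` candidates has a connected set with at least `k`
neighbors. -/
theorem exists_connSet_of_card_candidates (hG : G.ConnSet Finset.univ) {k : ℕ}
    (hk : k ^ 4 < (G.candidates k).card) : ∃ C, G.ConnSet C ∧ k ≤ (G.nbhd C).card := by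
  classical
  by_contra! h
  -- All degrees are smaller than `k`.
  have hcl : ∀ v, (G.closedNbhd v).card ≤ k := fun v => by
    rw [card_closedNbhd]
    exact h {v} (.singleton v)
  let good : Finset (Finset V) := Finset.univ.filter fun S =>
    (∀ s ∈ S, ∀ s' ∈ S, s ≠ s' → Disjoint (G.closedNbhd s) (G.closedNbhd s')) ∧
      ∀ s ∈ S, 3 ≤ (G.nbhd {s}).card
  obtain ⟨S, hS, hmax⟩ := good.exists_max_image Finset.card ⟨∅, by simp [good]⟩
  simp only [good, Finset.mem_filter, Finset.mem_univ, true_and] at hS hmax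
  obtain ⟨C, hC, hSC⟩ := exists_connSet_of_disjoint hG hS.1 hS.2
  have hSk : S.card ≤ k := (hSC.trans_lt (h C hC)).le
  -- Every vertex of degree at least `3` is at distance at most `2` from `S`.
  have near : ∀ u, 3 ≤ (G.nbhd {u}).card →
      u ∈ (S.biUnion G.closedNbhd).biUnion G.closedNbhd := by
    intro u hu
    by_contra hfar
    have hdis : ∀ s ∈ S, Disjoint (G.closedNbhd u) (G.closedNbhd s) := by
      intro s hs
      rw [Finset.disjoint_left]
      intro w hw hw'
      refine hfar (Finset.mem_biUnion.2 ⟨w, Finset.mem_biUnion.2 ⟨s, hs, hw'⟩, ?_⟩)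
      rcases mem_closedNbhd.1 hw with rfl | hw
      · simp
      · exact mem_closedNbhd.2 (.inr hw.symm)
    have huu : u ∈ G.closedNbhd u := by simp
    have huS : u ∉ S := fun hs => Finset.disjoint_left.1 (hdis u hs) huu huu
    have := hmax (insert u S) ⟨?_, ?_⟩
    · rw [Finset.card_insert_of_notMem huS] at this
      omega
    · intro s hs s' hs' hne
      rcases Finset.mem_insert.1 hs with h1 | h1 <;> rcases Finset.mem_insert.1 hs' with h2 | h2
      · exact absurd (h1.trans h2.symm) hne
      · exact h1 ▸ hdis s' h2
      · exact h2 ▸ (hdis s h1).symm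
      · exact hS.1 s h1 s' h2 hne
    · intro s hs
      rcases Finset.mem_insert.1 hs with rfl | hs
      · exact hu
      · exact hS.2 s hs
  have hsub : G.candidates k ⊆
      ((S.biUnion G.closedNbhd).biUnion G.closedNbhd).biUnion G.closedNbhd := by
    intro v hv
    simp only [candidates, Finset.mem_filter, Finset.mem_univ, true_and] at hv
    obtain ⟨u, huv, hu | hu⟩ := hv
    · exact Finset.mem_biUnion.2 ⟨u, near u hu, mem_closedNbhd.2 (.inr huv)⟩
    · exact absurd (h {u} (.singleton u)) (not_lt.2 hu)
  have := calc
    (G.candidates k).card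
    _ ≤ S.card * k * k * k := by
        refine (Finset.card_le_card hsub).trans ?_
        refine (Finset.card_biUnion_le_card_mul _ _ _ fun v _ => hcl v).trans ?_
        gcongr
        refine (Finset.card_biUnion_le_card_mul _ _ _ fun v _ => hcl v).trans ?_
        gcongr
        exact Finset.card_biUnion_le_card_mul _ _ _ fun v _ => hcl v
    _ ≤ k * k * k * k := by gcongr
    _ = k ^ 4 := by ring
  omega

/-- The search space for connected sets with at least `k` neighbors: unless there are more than
`k ^ 4` candidates, such a set is cut out by a set of candidates. -/
theorem exists_connSet_iff (hG : G.ConnSet Finset.univ) (k : ℕ) :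
    (∃ C, G.ConnSet C ∧ k ≤ (G.nbhd C).card) ↔
      k ^ 4 < (G.candidates k).card ∨
        ∃ L ⊆ G.candidates k, ∃ r, k ≤ (G.nbhd (G.reachSet L r)).card := by
  constructor
  · rintro ⟨C, hC, hk⟩
    obtain ⟨C, hC, hk, hsub⟩ := exists_connSet_nbhd_subset_candidates hC hk
    obtain ⟨r, hr⟩ := hC.1
    exact .inr ⟨_, hsub, r, by rwa [hC.reachSet_nbhd hr]⟩
  · rintro (h | ⟨L, -, r, hr⟩)
    · exact exists_connSet_of_card_candidates hG h
    · exact ⟨_, connSet_reachSet L r, hr⟩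

end SimpleGraph

/-! ### Connected sets and first-in trees -/

namespace SimpleGraph

section

variable {V : Type*} [Fintype V] [DecidableEq V] {G : SimpleGraph V}

/-- The vertices of a rooted spanning tree that are not leaves form a connected set, and the leaves
are neighbors of it. -/
theorem exists_connSet_of_isSpanningTree {T : SimpleGraph V} (hT : IsSpanningTree G T) (r : V) :
    ∃ C, G.ConnSet C ∧ (leaves T r).ncard ≤ (G.nbhd C).card := by
  classical
  let C : Finset V := Finset.univ.filter fun v => v ∉ leaves T r
  have hC : ∀ v, v ∈ C ↔ v ∉ leaves T r := by simp [C]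
  have hrC : r ∈ C := (hC r).2 fun h => h.1 rfl
  have path : ∀ v, ∃ p : T.Walk r v, ∀ u ∈ p.support, u ≠ v → u ∈ C := by
    intro v
    obtain ⟨p, hp⟩ := (hT.2.connected.preconnected r v).exists_isPath
    exact ⟨p, fun u hu huv => (hC u).2 fun h => h.2 v ⟨huv, p, hp, hu⟩⟩
  refine ⟨C, ⟨⟨r, hrC⟩, fun A hA ⟨a, ha⟩ hne => ?_⟩, ?_⟩
  · by_cases hr : r ∈ A
    · obtain ⟨v, hv, hvA⟩ := Finset.exists_of_ssubset (hA.ssubset_of_ne hne)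
      obtain ⟨p, hp⟩ := path v
      obtain ⟨d, hd, h1, h2⟩ := p.exists_boundary_dart (A : Set V) hr hvA
      refine ⟨d.fst, h1, d.snd, ?_, h2, hT.1 d.adj⟩
      by_cases h : d.snd = v
      · exact h ▸ hv
      · exact hp _ (p.dart_snd_mem_support_of_mem_darts hd) h
    · obtain ⟨p, hp⟩ := path a
      obtain ⟨d, hd, h1, h2⟩ := p.exists_boundary_dart ((A : Set V)ᶜ) hr (by simpa using ha)
      refine ⟨d.snd, by simpa using h2, d.fst, ?_, h1, (hT.1 d.adj).symm⟩
      refine hp _ (p.dart_fst_mem_support_of_mem_darts hd) ?_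
      rintro h
      exact h1 (h ▸ ha)
  · rw [← Set.ncard_coe_finset]
    refine Set.ncard_le_ncard (fun l hl => ?_) (Finset.finite_toSet _)
    obtain ⟨p, hp⟩ := path l
    have hlC : l ∉ C := fun h => (hC l).1 h hl
    obtain ⟨d, hd, h1, h2⟩ := p.exists_boundary_dart (C : Set V) hrC hlC
    have h3 : d.snd = l := by
      by_contra h
      exact h2 (hp _ (p.dart_snd_mem_support_of_mem_darts hd) h)
    exact mem_nbhd.2 ⟨hlC, d.fst, h1, h3 ▸ hT.1 d.adj⟩

/-- A connected set can be enlarged to a dominating one without losing neighbors. -/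
theorem exists_dominating_connSet (hG : G.ConnSet Finset.univ) {k : ℕ} {C : Finset V}
    (hC : G.ConnSet C) (hk : k ≤ (G.nbhd C).card) :
    ∃ C, G.ConnSet C ∧ k ≤ (G.nbhd C).card ∧ ∀ v ∉ C, v ∈ G.nbhd C := by
  classical
  let good : Finset (Finset V) := Finset.univ.filter fun C => G.ConnSet C ∧ k ≤ (G.nbhd C).card
  obtain ⟨D, hD, hmax⟩ := good.exists_max_image Finset.card ⟨C, by simp [good, hC, hk]⟩
  simp only [good, Finset.mem_filter, Finset.mem_univ, true_and] at hD hmax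
  refine ⟨D, hD.1, hD.2, ?_⟩
  by_contra! h
  obtain ⟨v, hvD, hv⟩ := h
  obtain ⟨u, hu, y, -, hy, huy⟩ := hG.2 (D ∪ G.nbhd D) (Finset.subset_univ _)
    (hD.1.1.mono Finset.subset_union_left) (fun h => by
      have := h ▸ Finset.mem_univ v
      rcases Finset.mem_union.1 this with h | h
      · exact hvD h
      · exact hv h)
  simp only [Finset.mem_union, not_or] at hy
  have huD : u ∈ G.nbhd D :=
    (Finset.mem_union.1 hu).resolve_left fun h => hy.2 (mem_nbhd.2 ⟨hy.1, u, h, huy⟩)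
  have := hmax (insert u D) ⟨hD.1.insert_of_mem_nbhd huD, hD.2.trans ?_⟩
  · rw [Finset.card_insert_of_notMem (mem_nbhd.1 huD).1] at this
    omega
  · have hsub : insert y ((G.nbhd D).erase u) ⊆ G.nbhd (insert u D) := by
      refine Finset.insert_subset (mem_nbhd.2 ⟨by simp [huy.ne', hy.1], u, by simp, huy⟩) ?_
      intro w hw
      obtain ⟨hwu, hw⟩ := Finset.mem_erase.1 hw
      obtain ⟨hwD, x, hx, hxw⟩ := mem_nbhd.1 hw
      exact mem_nbhd.2 ⟨by simp [hwu, hwD], x, by simp [hx], hxw⟩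
    have h1 := Finset.card_le_card hsub
    rw [Finset.card_insert_of_notMem fun h => hy.2 (Finset.mem_of_mem_erase h),
      Finset.card_erase_of_mem huD] at h1
    have := Finset.card_pos.2 ⟨u, huD⟩
    omega

/-- A list in which every vertex but the first one has a neighbor that occurs earlier can be
continued so that it exhausts a given connected set. -/
theorem ConnSet.exists_continuation {X : Finset V} (hX : G.ConnSet X) {l : List V} (hl : l ≠ [])
    (hnd : l.Nodup) (hlX : ∀ v ∈ l, v ∈ X)
    (hs : ∀ i (hi : i < l.length), 0 < i → ∃ j, ∃ hj : j < i, G.Adj l[j] l[i]) :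
    ∃ L, l <+: L ∧ L.Nodup ∧ (∀ v, v ∈ L ↔ v ∈ X) ∧
      ∀ i (hi : i < L.length), 0 < i → ∃ j, ∃ hj : j < i, G.Adj L[j] L[i] := by
  induction hn : X.card - l.length using Nat.strong_induction_on generalizing l with
  | _ n ih =>
    subst hn
    by_cases h : l.toFinset = X
    · exact ⟨l, List.prefix_rfl, hnd, by simp [← h], hs⟩
    obtain ⟨u, hu, v, hv, hvl, huv⟩ := hX.2 l.toFinset (fun v hv => hlX v (by simpa using hv))
      (by simpa [List.toFinset_nonempty_iff] using hl) h
    simp only [List.mem_toFinset] at hu hvl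
    have hnd' : (l ++ [v]).Nodup := by
      rw [List.nodup_append]
      refine ⟨hnd, by simp, fun a ha b hb h => hvl ?_⟩
      rwa [← List.mem_singleton.1 hb, ← h]
    have hle : (l ++ [v]).length ≤ X.card := by
      rw [← List.toFinset_card_of_nodup hnd']
      refine Finset.card_le_card fun w hw => ?_
      simp only [List.mem_toFinset, List.mem_append, List.mem_singleton] at hw
      rcases hw with hw | rfl
      · exact hlX w hw
      · exact hv
    obtain ⟨L, h0, h⟩ := ih _ (by simp at hle ⊢; omega) (l := l ++ [v]) (by simp) hnd'
      (by
        intro w hw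
        simp only [List.mem_append, List.mem_singleton] at hw
        rcases hw with hw | rfl
        · exact hlX w hw
        · exact hv)
      (by
        intro i hi hi0
        by_cases hil : i < l.length
        · obtain ⟨j, hj, hadj⟩ := hs i hil hi0
          refine ⟨j, hj, ?_⟩
          rwa [List.getElem_append_left (by omega), List.getElem_append_left hil]
        · obtain ⟨j, hj, rfl⟩ := List.getElem_of_mem hu
          have hi' : i = l.length := by simp at hi; omega
          subst hi'
          refine ⟨j, hj, ?_⟩
          rw [List.getElem_append_left hj]
          simpa using huv) rfl
    exact ⟨L, (List.prefix_append l [v]).trans h0, h⟩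

/-- A connected set can be visited first by a Generic Search. -/
theorem ConnSet.exists_isGSOrdering (hG : G.ConnSet Finset.univ) {C : Finset V}
    (hC : G.ConnSet C) :
    ∃ (m : ℕ) (σ : Fin m ≃ V), IsGSOrdering G σ ∧ ∀ u ∈ C, ∀ v ∉ C, σ.symm u < σ.symm v := by
  obtain ⟨r, hr⟩ := hC.1
  obtain ⟨l, h0, h1, h2, h3⟩ := hC.exists_continuation (l := [r]) (by simp) (by simp)
    (by simpa using hr) (by
      intro i hi h0
      simp at hi
      omega)
  have hl : l ≠ [] := List.ne_nil_of_mem ((h2 r).2 hr)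
  obtain ⟨L, h0', h1', h2', h3'⟩ := hG.exists_continuation hl h1 (by simp) h3
  refine ⟨_, h1'.getEquivOfForallMemList _ fun v => (h2' v).2 (Finset.mem_univ v), ?_, ?_⟩
  · intro i hi
    obtain ⟨j, hj, hadj⟩ := h3' i i.2 hi
    exact ⟨⟨j, hj.trans i.2⟩, hj, hadj⟩
  · intro u hu v hv
    obtain ⟨i, hi, rfl⟩ := List.getElem_of_mem ((h2 u).2 hu)
    set σ := h1'.getEquivOfForallMemList _ fun v => (h2' v).2 (Finset.mem_univ v)
    have hi' : σ ⟨i, hi.trans_le h0'.length_le⟩ = l[i] := (h0'.getElem hi).symm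
    rw [← hi', Equiv.symm_apply_apply]
    by_contra! hle
    refine hv ((h2 v).1 ?_)
    have hlt : (σ.symm v).val < l.length := lt_of_le_of_lt (Fin.le_def.1 hle) hi
    have : σ (σ.symm v) = l[(σ.symm v).val] := (h0'.getElem hlt).symm
    rw [Equiv.apply_symm_apply] at this
    rw [this]
    exact List.getElem_mem hlt

/-- The first-in tree of a Generic Search ordering that visits the vertices of a connected
dominating set `C` first. All parents belong to `C`, so the other vertices are leaves. -/
theorem exists_isFTree {C : Finset V} (hC : G.ConnSet C) (hdom : ∀ v ∉ C, v ∈ G.nbhd C) {m : ℕ}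
    {σ : Fin m ≃ V} (hσ : IsGSOrdering G σ) (hfirst : ∀ u ∈ C, ∀ v ∉ C, σ.symm u < σ.symm v) :
    ∃ T r, IsFTree G σ T r ∧ ∀ v ∉ C, v ∈ leaves T r := by
  classical
  obtain ⟨c, hc⟩ := hC.1
  have hm : 0 < m := (Nat.zero_le _).trans_lt (σ.symm c).2
  obtain ⟨r, hr⟩ : ∃ r, (σ.symm r).val = 0 := ⟨σ ⟨0, hm⟩, by simp⟩
  have hrC : r ∈ C := by
    by_contra h
    have := Fin.lt_def.1 (hfirst c hc r h)
    omega
  have hparent : ∀ v, ∃ u, v ≠ r → IsFirstNeighbor G σ u v := by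
    intro v
    by_cases hv : v = r
    · exact ⟨r, fun h => absurd hv h⟩
    have h0 : 0 < (σ.symm v).val := by
      by_contra h
      exact hv (σ.symm.injective (Fin.ext (by omega)))
    obtain ⟨j, -, hj⟩ := hσ _ h0
    rw [Equiv.apply_symm_apply] at hj
    obtain ⟨u, hu, hmin⟩ := (Finset.univ.filter fun w => G.Adj v w).exists_min_image
      (fun w => σ.symm w) ⟨σ j, by simpa using hj.symm⟩
    simp only [Finset.mem_filter, Finset.mem_univ, true_and] at hu hmin
    exact ⟨u, fun _ => ⟨hu, hmin⟩⟩
  choose p hp using hparent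
  have hlt : ∀ v, v ≠ r → σ.symm (p v) < σ.symm v := by
    intro v hv
    have h0 : 0 < (σ.symm v).val := by
      by_contra h
      exact hv (σ.symm.injective (Fin.ext (by omega)))
    obtain ⟨j, hj, hadj⟩ := hσ _ h0
    rw [Equiv.apply_symm_apply] at hadj
    refine lt_of_le_of_lt ((hp v hv).2 _ hadj.symm) ?_
    simpa using hj
  have hpC : ∀ v, v ≠ r → p v ∈ C := by
    intro v hv
    obtain ⟨x, hx, hvx⟩ : ∃ x ∈ C, G.Adj v x := by
      by_cases hvC : v ∈ C
      · obtain ⟨a, ha, x, hx, -, hax⟩ := hC.2 {v} (by simpa using hvC) (by simp) (by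
          rintro rfl
          exact hv (Finset.mem_singleton.1 hrC).symm)
        exact ⟨x, hx, Finset.mem_singleton.1 ha ▸ hax⟩
      · obtain ⟨-, x, hx, hxv⟩ := mem_nbhd.1 (hdom v hvC)
        exact ⟨x, hx, hxv.symm⟩
    by_contra h
    exact absurd ((hp v hv).2 x hvx) (not_le.2 (hfirst x hx _ h))
  let T : SimpleGraph V :=
    { Adj := fun u v => (v ≠ r ∧ u = p v) ∨ (u ≠ r ∧ v = p u)
      symm := ⟨fun u v h => h.symm⟩
      loopless := ⟨fun v h => by
        have key : v ≠ r ∧ v = p v := by tauto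
        exact absurd (hlt v key.1) (by rw [← key.2]; exact lt_irrefl _)⟩ }
  have path : ∀ n v, (σ.symm v).val = n → ∃ q : T.Walk r v, q.IsPath ∧
      ∀ x ∈ q.support, x = v ∨ (σ.symm x < σ.symm v ∧ x ∈ C) := by
    intro n
    induction n using Nat.strong_induction_on with
    | _ n ih =>
      rintro v rfl
      by_cases hv : v = r
      · subst hv
        exact ⟨.nil, by simp, by simp⟩
      · obtain ⟨q, hq, hqs⟩ := ih _ (Fin.lt_def.1 (hlt v hv)) (p v) rfl
        have hlt' : ∀ x ∈ q.support, σ.symm x < σ.symm v := by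
          intro x hx
          rcases hqs x hx with rfl | hx
          · exact hlt v hv
          · exact hx.1.trans (hlt v hv)
        have hadj : T.Adj (p v) v := .inl ⟨hv, rfl⟩
        refine ⟨q.concat hadj, hq.concat (fun h => lt_irrefl _ (hlt' v h)) hadj, fun x hx => ?_⟩
        rw [Walk.support_concat, List.mem_append, List.mem_singleton] at hx
        rcases hx with hx | rfl
        · refine .inr ⟨hlt' x hx, ?_⟩
          rcases hqs x hx with rfl | hx
          · exact hpC v hv
          · exact hx.2
        · exact .inl rfl
  have hconn : T.Connected := by
    rw [connected_iff_exists_forall_reachable]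
    exact ⟨r, fun v => (path _ v rfl).elim fun q _ => ⟨q⟩⟩
  have hcard : Nat.card T.edgeSet + 1 = Nat.card V := by
    refine le_antisymm ?_ hconn.card_vert_le_card_edgeSet_add_one
    have h1 : T.edgeSet ⊆ ((Finset.univ.erase r).image fun v => s(p v, v) : Finset (Sym2 V)) := by
      intro e
      induction e with
      | _ u v =>
        rw [mem_edgeSet]
        rintro (⟨h, rfl⟩ | ⟨h, rfl⟩)
        · simpa using ⟨v, h, .inl ⟨rfl, rfl⟩⟩
        · simpa using ⟨u, h, .inr ⟨rfl, rfl⟩⟩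
    have h2 : Nat.card T.edgeSet ≤ (Finset.univ.erase r).card := by
      rw [Nat.card_coe_set_eq]
      refine (Set.ncard_le_ncard h1 (Finset.finite_toSet _)).trans ?_
      rw [Set.ncard_coe_finset]
      exact Finset.card_image_le
    rw [Finset.card_erase_of_mem (Finset.mem_univ r), Finset.card_univ, ← Nat.card_eq_fintype_card]
      at h2
    have : 0 < Nat.card V := Finite.card_pos_iff.2 ⟨r⟩
    omega
  have htree : T.IsTree := isTree_iff_connected_and_card.2 ⟨hconn, hcard⟩
  have support : ∀ u v, IsDescendant T r u v → σ.symm u < σ.symm v ∧ u ∈ C := by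
    rintro u v ⟨huv, q, hq, hu⟩
    obtain ⟨q', hq', hs⟩ := path _ v rfl
    have : q = q' := congrArg Subtype.val
      ((htree.isAcyclic.subsingleton_path r v).elim ⟨q, hq⟩ ⟨q', hq'⟩)
    exact (hs u (this ▸ hu)).resolve_left huv
  refine ⟨T, r, ⟨⟨fun u v h => ?_, htree⟩, hr, fun u v hv ⟨hadj, hdesc⟩ => ?_⟩,
    fun v hv => ⟨?_, ?_⟩⟩
  · rcases h with ⟨h, rfl⟩ | ⟨h, rfl⟩
    · exact (hp v h).1.symm
    · exact (hp u h).1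
  · rcases hadj with ⟨_, rfl⟩ | ⟨h, rfl⟩
    · exact hp v hv
    · exact absurd (support _ _ hdesc).1 (hlt u h).not_gt
  · rintro rfl
    exact hv hrC
  · exact fun w h => hv (support _ _ h).2

end

/-- A connected graph has a Generic Search ordering whose first-in tree has at least `k` leaves if
and only if it has a connected set of vertices with at least `k` neighbors. -/
theorem exists_isFTree_iff {n : ℕ} {G : SimpleGraph (Fin n)} (hG : G.Connected) (k : ℕ) :
    (∃ (σ : Fin n ≃ Fin n) (T : SimpleGraph (Fin n)) (r : Fin n),
      IsGSOrdering G σ ∧ IsFTree G σ T r ∧ k ≤ (leaves T r).ncard) ↔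
    ∃ C, G.ConnSet C ∧ k ≤ (G.nbhd C).card := by
  constructor
  · rintro ⟨σ, T, r, -, hT, hk⟩
    obtain ⟨C, hC, hle⟩ := exists_connSet_of_isSpanningTree hT.1 r
    exact ⟨C, hC, hk.trans hle⟩
  · rintro ⟨C, hC, hk⟩
    obtain ⟨C, hC, hk, hdom⟩ := exists_dominating_connSet hG.connSet_univ hC hk
    obtain ⟨m, σ, hσ, hfirst⟩ := ConnSet.exists_isGSOrdering hG.connSet_univ hC
    obtain rfl : m = n := by simpa using Fintype.card_congr σ
    obtain ⟨T, r, hT, hl⟩ := exists_isFTree hC hdom hσ hfirst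
    refine ⟨σ, T, r, hσ, hT, hk.trans ?_⟩
    rw [← Set.ncard_coe_finset]
    exact Set.ncard_le_ncard (fun v hv => hl v (mem_nbhd.1 hv).1) (Set.toFinite _)

end SimpleGraph

/-! ### The algorithm -/

/-- The entry `(i, j)` of the adjacency matrix in the encoding of a graph with `n` vertices. -/
def adjBit (x : List Bool) (n i j : ℕ) : Bool := x.getD (n + 1 + i * n + j) false

/-- The degree of a vertex. -/
def degBit (x : List Bool) (n i : ℕ) : ℕ := cnt n fun j => adjBit x n i j

/-- Does `x` encode a graph with `n` vertices? -/
def isGraphCode (x : List Bool) (n : ℕ) : Bool :=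
  decide (x.length = n + 1 + n * n) && ball n (fun i => x.getD i false) && !x.getD n false &&
    ball n fun i => !adjBit x n i i && ball n fun j => !adjBit x n i j || adjBit x n j i

/-- One round of a search: the set `S` together with the neighbors of `S` outside of `L`. -/
def reachStep (x : List Bool) (n : ℕ) (L S : List Bool) : List Bool :=
  tab n fun i => S.getD i false ||
    (!L.getD i false && bex n fun j => S.getD j false && adjBit x n j i)

/-- The table of the vertices that can be reached from `r` by a walk that enters no vertex of
`L`. -/
def reachTab (x : List Bool) (n : ℕ) (L : List Bool) (r : ℕ) : List Bool :=
  Nat.rec (tab n fun i => decide (i = r)) (fun _ S => reachStep x n L S) n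

/-- The number of neighbors of the set with table `S`. -/
def nbhdCount (x : List Bool) (n : ℕ) (S : List Bool) : ℕ :=
  cnt n fun i => !S.getD i false && bex n fun j => S.getD j false && adjBit x n j i

/-- The table of the candidates for leaves. -/
def candTab (x : List Bool) (n k : ℕ) : List Bool :=
  tab n fun v => bex n fun u => adjBit x n u v &&
    (decide (3 ≤ degBit x n u) || decide (k ≤ degBit x n u))

/-- The subset number `t` of the set with table `Q`: bit `e` of `t` tells whether the subset
contains the element of the set that is preceded by `e` others. -/
def subsetTab (Q : List Bool) (n t : ℕ) : List Bool :=
  tab n fun i => Q.getD i false && t.testBit (cnt i fun j => Q.getD j false)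

/-- The algorithm: is `x` the encoding of a connected nonempty graph in which some connected set of
vertices has at least `k` neighbors? The numbers `m = k ^ 4` and `M = 2 ^ m` bound the number of
candidates and of sets of candidates. -/
def solve (x : List Bool) (k m M : ℕ) : Bool :=
  bex x.length fun n => isGraphCode x n && decide (0 < n) &&
    ball n (fun i => (reachTab x n [] 0).getD i false) &&
    (decide (m < cnt n fun i => (candTab x n k).getD i false) ||
      bex M fun t => bex n fun r =>
        decide (k ≤ nbhdCount x n (reachTab x n (subsetTab (candTab x n k) n t) r)))

/-! ### The algorithm runs in polynomial time -/

namespace FP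

variable {α : Type} [Data α] {x L S : α → List Bool} {n i j k m M t r : α → ℕ}

@[fun_prop]
theorem adjBit (hx : FP x) (hn : FP n) (hi : FP i) (hj : FP j) :
    FP fun a => adjBit (x a) (n a) (i a) (j a) := by
  unfold _root_.adjBit
  fun_prop

@[fun_prop]
theorem degBit (hx : FP x) (hn : FP n) (hi : FP i) : FP fun a => degBit (x a) (n a) (i a) := by
  unfold _root_.degBit
  fun_prop

@[fun_prop]
theorem isGraphCode (hx : FP x) (hn : FP n) : FP fun a => isGraphCode (x a) (n a) := by
  unfold _root_.isGraphCode
  fun_prop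

@[fun_prop]
theorem reachStep (hx : FP x) (hn : FP n) (hL : FP L) (hS : FP S) :
    FP fun a => reachStep (x a) (n a) (L a) (S a) := by
  unfold _root_.reachStep
  fun_prop

@[fun_prop]
theorem reachTab (hx : FP x) (hn : FP n) (hL : FP L) (hr : FP r) :
    FP fun a => reachTab (x a) (n a) (L a) (r a) := by
  refine list_rec (g := fun a _ S => _root_.reachStep (x a) (n a) (L a) S) hn (by fun_prop)
    (by fun_prop) hn.polyBdd fun a i _ => ?_
  cases i with
  | zero => exact (length_tab _ _).le
  | succ i => exact (length_tab _ _).le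

@[fun_prop]
theorem nbhdCount (hx : FP x) (hn : FP n) (hS : FP S) :
    FP fun a => nbhdCount (x a) (n a) (S a) := by
  unfold _root_.nbhdCount
  fun_prop

@[fun_prop]
theorem candTab (hx : FP x) (hn : FP n) (hk : FP k) : FP fun a => candTab (x a) (n a) (k a) := by
  unfold _root_.candTab
  fun_prop

@[fun_prop]
theorem subsetTab (hS : FP S) (hn : FP n) (ht : FP t) :
    FP fun a => subsetTab (S a) (n a) (t a) := by
  unfold _root_.subsetTab
  fun_prop

@[fun_prop]
theorem solve (hx : FP x) (hk : FP k) (hm : FP m) (hM : FP M) :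
    FP fun a => solve (x a) (k a) (m a) (M a) := by
  unfold _root_.solve
  fun_prop

end FP

/-! ### The algorithm is correct -/

theorem cnt_eq_card (n : ℕ) (P : ℕ → Bool) :
    cnt n P = (Finset.univ.filter fun i : Fin n => P i = true).card := by
  rw [cnt_eq, ← Finset.card_map Fin.valEmbedding]
  congr 1
  ext i
  simp only [Finset.mem_filter, Finset.mem_range, Finset.mem_map, Finset.mem_univ, true_and,
    Fin.valEmbedding_apply]
  exact ⟨fun h => ⟨⟨i, h.1⟩, h.2, rfl⟩, by rintro ⟨j, h, rfl⟩; exact ⟨j.2, h⟩⟩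

theorem cnt_lt_cnt {i j : ℕ} (h : i < j) {P : ℕ → Bool} (hP : P i = true) : cnt i P < cnt j P := by
  rw [cnt_eq, cnt_eq]
  refine Finset.card_lt_card (Finset.ssubset_iff_subset_ne.2
    ⟨Finset.filter_subset_filter _ (Finset.range_mono h.le), fun he => ?_⟩)
  have : i ∈ (Finset.range i).filter fun i => P i = true := he ▸ by simp [h, hP]
  simp at this

/-- The subset of `Fin n` with a given table. -/
def bits (n : ℕ) (S : List Bool) : Finset (Fin n) :=
  Finset.univ.filter fun i => S.getD i false = true

@[simp]
theorem mem_bits {n : ℕ} {S : List Bool} {i : Fin n} : i ∈ bits n S ↔ S.getD i false = true := by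
  simp [bits]

theorem bex_iff_fin {n : ℕ} {P : ℕ → Bool} : bex n P = true ↔ ∃ i : Fin n, P i = true :=
  bex_iff.trans ⟨fun ⟨i, h, hi⟩ => ⟨⟨i, h⟩, hi⟩, fun ⟨i, hi⟩ => ⟨i, i.2, hi⟩⟩

theorem ball_iff_fin {n : ℕ} {P : ℕ → Bool} : ball n P = true ↔ ∀ i : Fin n, P i = true :=
  ball_iff.trans ⟨fun h i => h i i.2, fun h i hi => h ⟨i, hi⟩⟩

theorem bits_subsetTab_subset (Q : List Bool) (n t : ℕ) :
    bits n (subsetTab Q n t) ⊆ bits n Q := by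
  intro i hi
  rw [mem_bits, subsetTab, getD_tab i.2, Bool.and_eq_true] at hi
  exact mem_bits.2 hi.1

/-- If a set has at most `m` elements, then its subsets have numbers below `2 ^ m`. -/
theorem exists_bits_subsetTab_eq {Q : List Bool} {n m : ℕ}
    (hm : cnt n (fun i => Q.getD i false) ≤ m) {L : Finset (Fin n)} (hL : L ⊆ bits n Q) :
    ∃ t < 2 ^ m, bits n (subsetTab Q n t) = L := by
  classical
  set rk : ℕ → ℕ := fun i => cnt i fun j => Q.getD j false with hrk
  -- Bit `e` tells whether the element of rank `e` in the table `Q` belongs to `L`.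
  refine ⟨Nat.ofBits fun e : Fin m => decide (∃ i ∈ L, rk i = e), Nat.ofBits_lt_two_pow _, ?_⟩
  ext i
  rw [mem_bits, subsetTab, getD_tab i.2, Bool.and_eq_true]
  constructor
  · rintro ⟨hi, ht⟩
    have hlt : rk i < m := (cnt_lt_cnt i.2 hi).trans_le hm
    rw [Nat.testBit_ofBits_lt _ _ hlt, decide_eq_true_eq] at ht
    obtain ⟨j, hj, hji⟩ := ht
    have hjQ := mem_bits.1 (hL hj)
    rcases lt_trichotomy i j with h | h | h
    · exact absurd hji (cnt_lt_cnt (P := fun j => Q.getD j false) h hi).ne'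
    · exact h ▸ hj
    · exact absurd hji (cnt_lt_cnt (P := fun j => Q.getD j false) h hjQ).ne
  · intro hi
    have hiQ := mem_bits.1 (hL hi)
    have hlt : rk i < m := (cnt_lt_cnt i.2 hiQ).trans_le hm
    refine ⟨hiQ, ?_⟩
    rw [Nat.testBit_ofBits_lt _ _ hlt, decide_eq_true_eq]
    exact ⟨i, hi, rfl⟩

/-- A sequence of growing subsets of a type with `n` elements that starts with a nonempty set and
in which each set determines the next one is constant from its term number `n` on. -/
theorem iterate_stabilizes {α : Type*} [Fintype α] [DecidableEq α] {F : Finset α → Finset α}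
    (hF : ∀ S, S ⊆ F S) {S : ℕ → Finset α} (h0 : (S 0).Nonempty) (hS : ∀ m, S (m + 1) = F (S m)) :
    F (S (Fintype.card α)) = S (Fintype.card α) := by
  -- Until it becomes constant, the sequence gains an element at each step.
  have key : ∀ m, S (m + 1) = S m ∨ m < (S m).card := by
    intro m
    induction m with
    | zero => exact Or.inr h0.card_pos
    | succ m ih =>
      by_cases h : S (m + 1) = S m
      · exact Or.inl (by rw [hS (m + 1), h, ← hS m, h])
      · have h1 : S m ⊂ S (m + 1) :=
          Finset.ssubset_iff_subset_ne.2 ⟨hS m ▸ hF _, Ne.symm h⟩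
        have := Finset.card_lt_card h1
        exact Or.inr (by have := ih.resolve_left h; omega)
  rcases key (Fintype.card α) with h | h
  · rw [← hS, h]
  · exact absurd (Finset.card_le_univ (S (Fintype.card α))) (not_le.2 h)

section Graph

variable {n : ℕ} {G : SimpleGraph (Fin n)} {x : List Bool}

theorem mem_bits_reachStep (hx : ∀ i j : Fin n, adjBit x n i j = true ↔ G.Adj i j)
    {L S : List Bool} {i : Fin n} : i ∈ bits n (reachStep x n L S) ↔
      i ∈ bits n S ∨ i ∉ bits n L ∧ ∃ j ∈ bits n S, G.Adj j i := by
  simp only [mem_bits, reachStep, getD_tab i.2, Bool.or_eq_true, Bool.and_eq_true, bex_iff_fin, hx,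
    Bool.not_eq_true']
  simp

theorem bits_reachTab (hx : ∀ i j : Fin n, adjBit x n i j = true ↔ G.Adj i j) (L : List Bool)
    (r : Fin n) : bits n (reachTab x n L r) = G.reachSet (bits n L) r := by
  classical
  set S : ℕ → List Bool := fun m => Nat.rec (tab n fun i => decide (i = r))
    (fun _ S => reachStep x n L S) m with hS
  have hmem0 : ∀ i, i ∈ bits n (S 0) ↔ i = r := fun i => by
    rw [mem_bits, show S 0 = tab n fun i => decide (i = r) from rfl, getD_tab i.2,
      decide_eq_true_eq, Fin.ext_iff]
  have hmem : ∀ m i, i ∈ bits n (S (m + 1)) ↔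
      i ∈ bits n (S m) ∨ i ∉ bits n L ∧ ∃ j ∈ bits n (S m), G.Adj j i :=
    fun m i => mem_bits_reachStep hx
  have hmono : Monotone fun m => bits n (S m) :=
    monotone_nat_of_le_succ fun m i hi => (hmem m i).2 (Or.inl hi)
  have hfix := iterate_stabilizes (S := fun m => bits n (S m))
    (F := fun A => Finset.univ.filter fun i => i ∈ A ∨ i ∉ bits n L ∧ ∃ j ∈ A, G.Adj j i)
    (fun A i hi => by simp [hi]) ⟨r, (hmem0 r).2 rfl⟩ fun m => by ext i; simp [hmem]
  rw [Fintype.card_fin] at hfix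
  change bits n (S n) = _
  ext v
  simp only [SimpleGraph.reachSet, Finset.mem_filter, Finset.mem_univ, true_and]
  constructor
  · have : ∀ m v, v ∈ bits n (S m) →
        Relation.ReflTransGen (fun u v => G.Adj u v ∧ v ∉ bits n L) r v := by
      intro m
      induction m with
      | zero =>
        intro v hv
        rw [(hmem0 v).1 hv]
      | succ m ih =>
        intro v hv
        rcases (hmem m v).1 hv with h | ⟨hvL, u, hu, huv⟩
        · exact ih v h
        · exact (ih u hu).tail ⟨huv, hvL⟩
    exact this n v
  · intro h
    induction h with
    | refl => exact hmono (Nat.zero_le n) ((hmem0 r).2 rfl)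
    | tail _ h ih =>
      rw [← hfix]
      exact Finset.mem_filter.2 ⟨Finset.mem_univ _, Or.inr ⟨h.2, _, ih, h.1⟩⟩

theorem nbhdCount_eq (hx : ∀ i j : Fin n, adjBit x n i j = true ↔ G.Adj i j) (S : List Bool) :
    nbhdCount x n S = (G.nbhd (bits n S)).card := by
  rw [nbhdCount, cnt_eq_card]
  congr 1
  ext i
  simp only [SimpleGraph.mem_nbhd, mem_bits, Finset.mem_filter, Finset.mem_univ, true_and,
    Bool.and_eq_true, bex_iff_fin, hx, Bool.not_eq_true']
  simp

theorem degBit_eq (hx : ∀ i j : Fin n, adjBit x n i j = true ↔ G.Adj i j) (u : Fin n) :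
    degBit x n u = (G.nbhd {u}).card := by
  rw [degBit, cnt_eq_card]
  congr 1
  ext i
  simp only [SimpleGraph.mem_nbhd, Finset.mem_filter, Finset.mem_univ, true_and, hx,
    Finset.mem_singleton, exists_eq_left]
  exact ⟨fun h => ⟨h.ne', h⟩, fun h => h.2⟩

theorem bits_candTab (hx : ∀ i j : Fin n, adjBit x n i j = true ↔ G.Adj i j) (k : ℕ) :
    bits n (candTab x n k) = G.candidates k := by
  ext v
  simp only [SimpleGraph.candidates, mem_bits, candTab, getD_tab v.2, bex_iff_fin, hx, degBit_eq hx,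
    Bool.and_eq_true, Bool.or_eq_true, decide_eq_true_eq, Finset.mem_filter, Finset.mem_univ,
    true_and]

theorem connected_iff_reachSet (r : Fin n) : G.Connected ↔ ∀ v, v ∈ G.reachSet ∅ r := by
  simp only [SimpleGraph.reachSet, Finset.notMem_empty, not_false_eq_true, and_true,
    Finset.mem_filter, Finset.mem_univ, true_and]
  constructor
  · intro h v
    exact (SimpleGraph.reachable_iff_reflTransGen r v).1 (h.preconnected r v)
  · intro h
    exact (SimpleGraph.connected_iff_exists_forall_reachable G).2
      ⟨r, fun v => (SimpleGraph.reachable_iff_reflTransGen r v).2 (h v)⟩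

/-! ### The encoding of graphs -/

theorem encodeGraph_eq (G : SimpleGraph (Fin n)) [DecidableRel G.Adj] :
    encodeGraph G = List.replicate n true ++ false ::
      List.ofFn fun e : Fin (n * n) => decide (G.Adj e.divNat e.modNat) := by
  classical
  rw [encodeGraph, List.ofFn_mul, List.flatMap_def, List.ofFn_eq_map]
  congr 4
  funext i
  rw [List.ofFn_eq_map]
  congr 1
  funext j
  have hj := j.2
  have h1 : (i * n + j : ℕ) / n = i := by
    rw [Nat.mul_comm, Nat.mul_add_div (by omega), Nat.div_eq_of_lt hj, add_zero]
  have h2 : (i * n + j : ℕ) % n = j := by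
    rw [Nat.mul_comm, Nat.mul_add_mod, Nat.mod_eq_of_lt hj]
  rw [decide_eq_decide]
  exact iff_of_eq (congrArg₂ G.Adj (Fin.ext h1.symm) (Fin.ext h2.symm))

theorem length_encodeGraph (G : SimpleGraph (Fin n)) :
    (encodeGraph G).length = n + 1 + n * n := by
  classical
  simp [encodeGraph_eq]
  ring

theorem getD_encodeGraph_of_lt (G : SimpleGraph (Fin n)) {i : ℕ} (h : i < n) :
    (encodeGraph G).getD i false = true := by
  simp [encodeGraph, List.getElem?_append_left, h]

theorem getD_encodeGraph_self (G : SimpleGraph (Fin n)) : (encodeGraph G).getD n false = false := by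
  simp [encodeGraph]

theorem adjBit_encodeGraph (G : SimpleGraph (Fin n)) (i j : Fin n) :
    adjBit (encodeGraph G) n i j = true ↔ G.Adj i j := by
  classical
  have hi := i.2
  have hj := j.2
  have h1 : (i * n + j : ℕ) / n = i := by
    rw [Nat.mul_comm, Nat.mul_add_div (by omega), Nat.div_eq_of_lt hj, add_zero]
  have h2 : (i * n + j : ℕ) % n = j := by
    rw [Nat.mul_comm, Nat.mul_add_mod, Nat.mod_eq_of_lt hj]
  have h3 : (i * n + j : ℕ) < n * n := by nlinarith
  rw [adjBit, encodeGraph_eq, List.getD_append_right _ _ _ _ (by simp; omega),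
    List.length_replicate, show n + 1 + i * n + j - n = (i * n + j : ℕ) + 1 by omega,
    List.getD_cons_succ, List.getD_eq_getElem _ _ (by simpa using h3), List.getElem_ofFn,
    decide_eq_true_eq]
  exact iff_of_eq (congrArg₂ G.Adj (Fin.ext h1) (Fin.ext h2))

theorem isGraphCode_iff {x : List Bool} :
    isGraphCode x n = true ↔ ∃ G : SimpleGraph (Fin n), x = encodeGraph G := by
  simp only [isGraphCode, Bool.and_eq_true, decide_eq_true_eq, ball_iff_fin, Bool.not_eq_true',
    Bool.or_eq_true]
  constructor
  · rintro ⟨⟨⟨hl, h1⟩, h2⟩, h3⟩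
    let G : SimpleGraph (Fin n) :=
      { Adj := fun i j => adjBit x n i j = true
        symm := ⟨fun i j h => ((h3 i).2 j).resolve_left (by simp [h])⟩
        loopless := ⟨fun i h => by simp [(h3 i).1] at h⟩ }
    refine ⟨G, List.ext_getElem (hl.trans (length_encodeGraph G).symm) fun e he he' => ?_⟩
    rw [← List.getD_eq_getElem _ false, ← List.getD_eq_getElem _ false]
    rcases lt_trichotomy e n with h | rfl | h
    · rw [getD_encodeGraph_of_lt G h]
      exact h1 ⟨e, h⟩
    · rw [h2, getD_encodeGraph_self]
    · have hlt : e - (n + 1) < n * n := by omega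
      have hn : 0 < n := Nat.pos_of_ne_zero fun h => by simp [h] at hlt
      have hdiv : (e - (n + 1)) / n < n := Nat.div_lt_of_lt_mul hlt
      have hmod : (e - (n + 1)) % n < n := Nat.mod_lt _ hn
      have key := adjBit_encodeGraph G ⟨_, hdiv⟩ ⟨_, hmod⟩
      have he : n + 1 + (e - (n + 1)) / n * n + (e - (n + 1)) % n = e := by
        have := Nat.div_add_mod' (e - (n + 1)) n
        omega
      simp only [G, adjBit, he] at key
      exact (Bool.eq_iff_iff.2 key).symm
  · rintro ⟨G, rfl⟩
    refine ⟨⟨⟨length_encodeGraph G, fun i => getD_encodeGraph_of_lt G i.2⟩,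
      getD_encodeGraph_self G⟩, fun i => ⟨?_, fun j => ?_⟩⟩
    · rw [← Bool.not_eq_true, adjBit_encodeGraph]
      exact G.loopless.irrefl i
    · rw [← Bool.not_eq_true, adjBit_encodeGraph, adjBit_encodeGraph, ← imp_iff_not_or]
      exact fun h => h.symm

end Graph

theorem mem_maxLeafFTreeGS_iff (x : List Bool) (k : ℕ) :
    (x, k) ∈ maxLeafFTreeGS ↔ solve x k (k ^ 4) (2 ^ k ^ 4) = true := by
  have key : ∀ (n : ℕ) (G : SimpleGraph (Fin n)), x = encodeGraph G → (G.Connected ∧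
      (∃ (σ : Fin n ≃ Fin n) (T : SimpleGraph (Fin n)) (r : Fin n),
        IsGSOrdering G σ ∧ IsFTree G σ T r ∧ k ≤ (leaves T r).ncard) ↔
      (0 < n ∧ (∀ i : Fin n, (reachTab x n [] 0).getD i false = true)) ∧
      (k ^ 4 < cnt n (fun i => (candTab x n k).getD i false) ∨ ∃ t < 2 ^ k ^ 4, ∃ r : Fin n,
        k ≤ nbhdCount x n (reachTab x n (subsetTab (candTab x n k) n t) r))) := by
    intro n G hG
    have hx : ∀ i j : Fin n, adjBit x n i j = true ↔ G.Adj i j := hG ▸ adjBit_encodeGraph G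
    have hconn : (0 < n ∧ (∀ i : Fin n, (reachTab x n [] 0).getD i false = true)) ↔
        G.Connected := by
      rcases Nat.eq_zero_or_pos n with rfl | hn
      · simpa using fun h : G.Connected => h.nonempty.elim fun i => i.elim0
      · have h1 := bits_reachTab hx [] ⟨0, hn⟩
        have h2 : bits n [] = ∅ := by ext; simp
        rw [connected_iff_reachSet ⟨0, hn⟩, ← h2, ← h1]
        simp [hn]
    rw [hconn]
    refine and_congr_right fun hc => ?_
    rw [SimpleGraph.exists_isFTree_iff hc, SimpleGraph.exists_connSet_iff hc.connSet_univ]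
    have hcnt : cnt n (fun i => (candTab x n k).getD i false) = (G.candidates k).card := by
      rw [← bits_candTab hx, cnt_eq_card, bits]
    simp only [nbhdCount_eq hx, bits_reachTab hx]
    by_cases hk : k ^ 4 < (G.candidates k).card
    · exact iff_of_true (Or.inl hk) (Or.inl (hcnt ▸ hk))
    rw [hcnt, or_iff_right hk, or_iff_right hk]
    constructor
    · rintro ⟨L, hL, r, hr⟩
      rw [← bits_candTab hx] at hL
      obtain ⟨t, ht, rfl⟩ := exists_bits_subsetTab_eq (hcnt ▸ not_lt.1 hk) hL
      exact ⟨t, ht, r, hr⟩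
    · rintro ⟨t, -, r, hr⟩
      exact ⟨_, bits_candTab hx k ▸ bits_subsetTab_subset _ _ _, r, hr⟩
  -- The quantifier over `t` ranges over numbers, the other ones over vertices.
  have hM : ∀ P : ℕ → Bool, bex (2 ^ k ^ 4) P = true ↔ ∃ t < 2 ^ k ^ 4, P t = true :=
    fun P => bex_iff
  rw [solve, bex_iff]
  simp only [hM, Bool.and_eq_true, Bool.or_eq_true, isGraphCode_iff, decide_eq_true_eq,
    bex_iff_fin, ball_iff_fin]
  constructor
  · rintro ⟨n, G, hG, h⟩
    obtain ⟨h1, h2⟩ := (key n G hG).1 h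
    refine ⟨n, ?_, ⟨⟨⟨G, hG⟩, h1.1⟩, h1.2⟩, h2⟩
    have : x.length = n + 1 + n * n := (congrArg _ hG).trans (length_encodeGraph G)
    omega
  · rintro ⟨n, -, ⟨⟨⟨G, hG⟩, h0⟩, h1⟩, h2⟩
    exact ⟨n, G, hG, (key n G hG).2 ⟨⟨h0, h1⟩, h2⟩⟩

/-! ### The problem is fixed-parameter tractable -/

/-- An instance of a parameterized problem. Unlike a pair, it is kept on a single stack, in the
encoding that a machine receives. -/
structure Instance where
  x : List Bool
  k : ℕ

/-- The size of an instance includes a function of the parameter. A running time that is polynomial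
in this size is therefore fixed-parameter tractable. -/
instance : Data Instance where
  size p := p.x.length + p.k + 1 + 2 ^ p.k ^ 4
  regs := [fun p => encodeInstance p.x p.k]
  length_le c hc p := by
    rw [List.mem_singleton.1 hc]
    refine le_trans (le_of_eq ?_) (Nat.le_add_right _ _)
    simp [encodeInstance]
    ring

namespace FP

theorem encode_instance : FP fun p : Instance => encodeInstance p.x p.k :=
  of_list (.var (List.mem_singleton_self _) (PolyBdd.self.mono fun p =>
    Data.length_le (α := Instance) _ (List.mem_singleton_self _) p))

@[fun_prop]
theorem instance_k : FP Instance.k := by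
  have h := encode_instance
  -- The parameter is the number of positions up to which all symbols are `true`.
  refine FP.of_eq (f := fun p : Instance => _root_.cnt (encodeInstance p.x p.k).length fun i =>
    _root_.ball (i + 1) fun j => (encodeInstance p.x p.k).getD j false) ?_ fun p => ?_
  · have h1 : FP fun q : Instance × ℕ => encodeInstance q.1.x q.1.k := h.comp (by fun_prop)
    have h2 : FP fun q : (Instance × ℕ) × ℕ => encodeInstance q.1.1.x q.1.1.k :=
      h.comp (f := fun q : (Instance × ℕ) × ℕ => q.1.1) (by fun_prop)
    fun_prop
  · rw [cnt_eq, ← Finset.card_range p.k]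
    congr 1
    ext i
    simp only [encodeInstance, Finset.mem_filter, Finset.mem_range, ball_iff]
    constructor
    · rintro ⟨-, h⟩
      by_contra hi
      have := h p.k (by omega)
      simp at this
    · intro hi
      refine ⟨by simp; omega, fun j hj => ?_⟩
      simp [List.getElem?_append_left, show j < p.k by omega]

@[fun_prop]
theorem instance_x : FP Instance.x := by
  have h := encode_instance
  refine FP.of_eq (f := fun p : Instance => (encodeInstance p.x p.k).drop (p.k + 1))
    (by fun_prop) fun p => ?_
  simp [encodeInstance, List.drop_append]

theorem two_pow_instance : FP fun p : Instance => 2 ^ p.k ^ 4 := by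
  have key : ∀ i, (Nat.rec 1 (fun _ m => m + m) i : ℕ) = 2 ^ i := by
    intro i
    induction i with
    | zero => rfl
    | succ i ih => simp only [ih, pow_succ, mul_two]
  have h4 : FP fun p : Instance => p.k * p.k * (p.k * p.k) := by fun_prop
  have h4 : FP fun p : Instance => p.k ^ 4 := h4.of_eq fun p => by ring
  refine (nat_rec (g := fun _ _ m => m + m) h4 (const_nat 1) (by fun_prop)
    PolyBdd.self fun p i hi => ?_).of_eq fun p => key _
  rw [key]
  exact (Nat.pow_le_pow_right two_pos hi).trans (Nat.le_add_left _ _)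

theorem solve_instance : FP fun p : Instance => _root_.solve p.x p.k (p.k ^ 4) (2 ^ p.k ^ 4) := by
  have h2 := two_pow_instance
  have h4 : FP fun p : Instance => p.k * p.k * (p.k * p.k) := by fun_prop
  have h4 : FP fun p : Instance => p.k ^ 4 := h4.of_eq fun p => by ring
  fun_prop

end FP

theorem computable_bound (c : ℕ) : Computable fun k : ℕ => (2 ^ k ^ 4 + 3) ^ c + 4 := by
  have hpow : Primrec₂ fun a b : ℕ => a ^ b := Primrec₂.unpaired'.1 Nat.Primrec.pow
  have h : Primrec fun k : ℕ => (2 ^ k ^ 4 + 3) ^ c + 4 :=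
    Primrec.nat_add.comp (hpow.comp (Primrec.nat_add.comp (hpow.comp (.const 2)
      (hpow.comp .id (.const 4))) (.const 3)) (.const c)) (.const 4)
  exact h.to_comp

/-- The number of steps on an instance of length `l`, where `e` is the part of its size that depends
on the parameter. Clearing the input stack at the end takes `2 * l + 1` steps. -/
theorem time_le {l e c : ℕ} (hl : 1 ≤ l) :
    (l + e + 2) ^ c + (2 * l + 1) + 1 ≤ ((e + 3) ^ c + 4) * l ^ (c + 1) := by
  have h1 : (l + e + 2) ^ c ≤ ((e + 3) * l) ^ c := Nat.pow_le_pow_left (by nlinarith) c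
  have h2 : l ^ c ≤ l ^ (c + 1) := Nat.pow_le_pow_right hl (Nat.le_succ c)
  have h3 : l ≤ l ^ (c + 1) := Nat.le_self_pow (Nat.succ_ne_zero c) l
  calc (l + e + 2) ^ c + (2 * l + 1) + 1 ≤ (e + 3) ^ c * l ^ (c + 1) + 4 * l ^ (c + 1) := by
        rw [mul_pow] at h1
        have := Nat.mul_le_mul_left ((e + 3) ^ c) h2
        omega
    _ = _ := (add_mul _ _ _).symm

theorem corollary3p7 : maxLeafFTreeGS ∈ FPT := by
  classical
  obtain ⟨p, T, ⟨c, hc⟩, hp⟩ := FP.solve_instance.to_bool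
  refine ⟨_, computable_bound c, c + 1,
    ⟨(p.seq (.clear 0)).machine, Equiv.refl _, Equiv.refl _⟩, fun s => ?_, fun x k => ?_⟩
  · change Finite Bool
    infer_instance
  · obtain ⟨t, ht, hr⟩ := hp ⟨x, k⟩
    have hin : load Data.regs (⟨x, k⟩ : Instance)
        = Function.update (fun _ => []) 0 (encodeInstance x k) := by
      funext i
      cases i <;> simp [load, Data.regs]
    have hlen : (encodeInstance x k).length = x.length + k + 1 := by
      simp [encodeInstance]
      ring
    have hout : decide ((x, k) ∈ maxLeafFTreeGS) = solve x k (k ^ 4) (2 ^ k ^ 4) :=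
      Bool.eq_iff_iff.2 (decide_eq_true_iff.trans (mem_maxLeafFTreeGS_iff x k))
    rw [hin] at hr
    have hq := hr.seq (StackCmd.run_clear _ 0)
    have hrun := hq.cast (s'' := Function.update (fun _ => []) 1
      [decide ((x, k) ∈ maxLeafFTreeGS)]) rfl (by
        funext i
        simp only [Function.update_apply, hout]
        split_ifs <;> simp_all [Data.regs])
    have key := hrun.outputs (T := ((2 ^ k ^ 4 + 3) ^ c + 4) *
      (encodeInstance x k).length ^ (c + 1)) ?_
    · rw [← List.map_id (encodeInstance x k), List.length_map] at key
      exact key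
    · refine le_trans ?_ (time_le (by omega))
      have h1 := ht.trans (hc ⟨x, k⟩)
      have h2 : Data.size (⟨x, k⟩ : Instance) = (encodeInstance x k).length + 2 ^ k ^ 4 := by
        rw [hlen]; rfl
      rw [h2] at h1
      have h3 : (Function.update (Function.update (fun _ => []) 0 (encodeInstance x k))
        (Data.regs (α := Instance)).length [solve x k (k ^ 4) (2 ^ k ^ 4)] 0).length
          = (encodeInstance x k).length := by
        simp [Data.regs]
      rw [h3]
      omega
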